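/- Let $\ell\ge 2$ and $n\ge 0$ be integers and let $F(x,y_0,y_1,\dots,y_n)$ be holomorphic in a neighbourhood of $0\in\mathbb C^{n+2}$. A generalized power series is a formal series $$\varphi=\sum_{k=1}^{\infty}c_kx^{\lambda_k},\qquad c_k\in\mathbb C,$$ with pairwise distinct exponents $\lambda_k\in\mathbb C$ such that $0<\operatorname{Re}\lambda_1\le\operatorname{Re}\lambda_2\le\dots\to+\infty$. Put $\mu\varphi=\sum_k c_kx^{\ell\lambda_k}$. If $G$ is holomorphic near $0\in\mathbb C^{n+2}$, then $G(x,\varphi,\mu\varphi,\dots,\mu^n\varphi)$ denotes the formal series in complex powers of $x$ obtained by substituting $x,\varphi,\mu\varphi,\dots,\mu^n\varphi$ into the Taylor series of $G$ at $0$; this is well defined, because each coefficient receives contributions from only finitely many terms. Theorem. Let $\varphi$ be a formal solution of the Mahler equation $$F\bigl(x,y(x),y(x^{\ell}),\dots,y(x^{\ell^n})\bigr)=0,$$ that is, let all coefficients of $F(x,\varphi,\mu\varphi,\dots,\mu^n\varphi)$ be zero, and suppose that for some $\nu\in\mathbb C$ and some $A_0\in\mathbb C\setminus\{0\}$ $$\frac{\partial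 F}{\partial y_0}(x,\varphi,\mu\varphi,\dots,\mu^n\varphi)=A_0x^{\nu}+o(x^{\nu}),$$ where $o(x^\nu)$ denotes a formal series all of whose exponents have real part strictly greater than $\operatorname{Re}\nu$. Then for every open sector $S$ with vertex $0$ and opening less than $2\pi$, and for every continuous branch of $\log x$ on $S$ (with $x^{\lambda}=e^{\lambda\log x}$), there is $R>0$ such that the series $\sum_k c_kx^{\lambda_k}$ converges uniformly on $\{x\in S:\ |x|<R\}$. -/

import Mathlib

open Filter Topology

noncomputable section

namespace GenSeries

/-- Exponents: complex numbers, ordered lexicographically by (real part, imaginary part). The order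
only serves to make Mathlib's ring of Hahn series available for formal computations. -/
abbrev Expo : Type := ℝ ×ₗ ℝ

/-- The exponent attached to a complex number. -/
def expo (z : ℂ) : Expo := toLex (z.re, z.im)

theorem expo_injective : Function.Injective expo := by
  intro a b h
  have h' : (a.re, a.im) = (b.re, b.im) := toLex.injective h
  exact Complex.ext (congrArg Prod.fst h') (congrArg Prod.snd h')

/-- A set of exponents with finitely many elements in each half-plane `Re ≤ r` is well ordered. -/
theorem isPWO_of_finite {s : Set Expo} (hs : ∀ r : ℝ, {γ ∈ s | (ofLex γ).1 ≤ r}.Finite) :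
    s.IsPWO := by
  rw [Set.isPWO_iff_isWF, Set.isWF_iff_no_descending_seq]
  intro f hf hsub
  have hfin := hs (ofLex (f 0)).1
  have hmem : ∀ k, f k ∈ {γ ∈ s | (ofLex γ).1 ≤ (ofLex (f 0)).1} := by
    intro k
    refine ⟨hsub k, ?_⟩
    have hk : f k ≤ f 0 := hf.antitone (Nat.zero_le k)
    exact (Prod.Lex.monotone_fst _ _ hk)
  exact Set.infinite_of_injective_forall_mem hf.injective hmem hfin

/-- A generalized power series `∑ c_k x^{λ_k}` with pairwise distinct complex exponents such that
`0 < Re λ_0 ≤ Re λ_1 ≤ … → +∞`. Zero coefficients are allowed. -/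
structure GenPowerSeries where
  coeff : ℕ → ℂ
  exponent : ℕ → ℂ
  exponent_injective : Function.Injective exponent
  re_pos : ∀ k, 0 < (exponent k).re
  re_mono : Monotone fun k => (exponent k).re
  re_tendsto : Tendsto (fun k => (exponent k).re) atTop atTop

/-- The formal object `∑ c_k x^{λ_k}`: its coefficient at the exponent `λ_k` is `c_k`, and its
coefficient at any exponent which is not among the `λ_k` is zero. -/
def GenPowerSeries.toHahn (φ : GenPowerSeries) : HahnSeries Expo ℂ where
  coeff γ := ∑ᶠ k, if expo (φ.exponent k) = γ then φ.coeff k else 0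
  isPWO_support' := by
    refine isPWO_of_finite fun r => ?_
    have h1 : {k | (φ.exponent k).re ≤ r}.Finite := by
      have h2 := φ.re_tendsto.eventually (eventually_gt_atTop r)
      obtain ⟨K, hK⟩ := eventually_atTop.1 h2
      refine (Set.finite_lt_nat K).subset fun k hk => ?_
      by_contra hlt
      exact absurd (hK k (not_lt.1 hlt)) (not_lt.2 hk)
    refine (h1.image fun k => expo (φ.exponent k)).subset ?_
    rintro γ ⟨hγ, hr⟩
    obtain ⟨k, hk⟩ : ∃ k, expo (φ.exponent k) = γ := by
      by_contra hne
      push Not at hne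
      exact hγ (by simp [hne])
    subst hk
    exact ⟨k, hr, rfl⟩

theorem GenPowerSeries.toHahn_coeff (φ : GenPowerSeries) (k : ℕ) :
    φ.toHahn.coeff (expo (φ.exponent k)) = φ.coeff k := by
  change (∑ᶠ j, if expo (φ.exponent j) = expo (φ.exponent k) then φ.coeff j else 0) = _
  rw [finsum_eq_single _ k]
  · simp
  · intro j hj
    simp [expo_injective.eq_iff, φ.exponent_injective.eq_iff, hj]

/-- Multiplication of exponents by `ℓ ≥ 2`. -/
def expoScale (ℓ : ℕ) (hℓ : 2 ≤ ℓ) : Expo ↪o Expo :=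
  OrderEmbedding.ofStrictMono (fun γ => ℓ • γ) (fun _ _ h => nsmul_lt_nsmul_right (by omega) h)

/-- The Mahler operator `μ : y(x) ↦ y(x^ℓ)`, i.e. `∑ c x^λ ↦ ∑ c x^{ℓ λ}`. -/
def mahlerOp (ℓ : ℕ) (hℓ : 2 ≤ ℓ) (f : HahnSeries Expo ℂ) : HahnSeries Expo ℂ :=
  HahnSeries.embDomain (expoScale ℓ hℓ) f

/-- The formal monomial `x`. -/
def monomialX : HahnSeries Expo ℂ := HahnSeries.single (expo 1) 1

/-- The tuple `(x, φ, μφ, …, μ^n φ)`: coordinate `0` is `x`, coordinate `j + 1` is `μ^j φ`. -/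
def mahlerTuple (n ℓ : ℕ) (hℓ : 2 ≤ ℓ) (φ : GenPowerSeries) : Fin (n + 2) → HahnSeries Expo ℂ :=
  Fin.cons monomialX fun j : Fin (n + 1) => (mahlerOp ℓ hℓ)^[(j : ℕ)] φ.toHahn

/-- The homogeneous part of degree `d` of the Taylor series at `0` of a function `G` of `m`
variables, as a polynomial:
`(1 / d!) ∑_{i_1, …, i_d} (∂_{i_1} ⋯ ∂_{i_d} G)(0) X_{i_1} ⋯ X_{i_d}`. -/
def taylorPart {m : ℕ} (G : (Fin m → ℂ) → ℂ) (d : ℕ) : MvPolynomial (Fin m) ℂ :=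
  ∑ i : Fin d → Fin m,
    MvPolynomial.C ((d.factorial : ℂ)⁻¹ *
      iteratedFDeriv ℂ d G 0 fun k => Pi.single (i k) (1 : ℂ)) * ∏ k, MvPolynomial.X (i k)

/-- The coefficient at `x^ν` of the formal series `G(Φ) = ∑_d G_d(Φ)`, where `G_d` is the
homogeneous part of degree `d` of the Taylor series of `G` at `0`. When all exponents of the entries
of `Φ` have real part at least some `ε > 0`, only finitely many `d` contribute: see
`support_substCoeff_finite` and `mahlerTuple_re_ge`. -/
def substCoeff {m : ℕ} (G : (Fin m → ℂ) → ℂ) (Φ : Fin m → HahnSeries Expo ℂ) (ν : ℂ) : ℂ :=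
  ∑ᶠ d : ℕ, (MvPolynomial.aeval Φ (taylorPart G d)).coeff (expo ν)

/-- `φ` is a formal solution of `F(x, y(x), y(x^ℓ), …, y(x^{ℓ^n})) = 0`: all coefficients of
`F(x, φ, μφ, …, μ^n φ)` vanish. -/
def IsFormalMahlerSolution (n ℓ : ℕ) (hℓ : 2 ≤ ℓ) (F : (Fin (n + 2) → ℂ) → ℂ)
    (φ : GenPowerSeries) : Prop :=
  ∀ κ : ℂ, substCoeff F (mahlerTuple n ℓ hℓ φ) κ = 0

/-- The partial derivative `∂F/∂y_0` of `F(x, y_0, …, y_n)`. -/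
def partialY0 {n : ℕ} (F : (Fin (n + 2) → ℂ) → ℂ) (z : Fin (n + 2) → ℂ) : ℂ :=
  fderiv ℂ F z (Pi.single 1 1)

/-- The formal series with coefficients `a` has the form `A x^ν + o(x^ν)`, where `o(x^ν)` stands for
a series all of whose exponents have real part greater than `Re ν`. -/
def HasForm (a : ℂ → ℂ) (A ν : ℂ) : Prop :=
  a ν = A ∧ ∀ κ : ℂ, κ ≠ ν → κ.re ≤ ν.re → a κ = 0

/-- The open sector `{r e^{iθ} : r > 0, α < θ < β}` with vertex `0`. -/
def sector (α β : ℝ) : Set ℂ :=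
  {x | ∃ r θ : ℝ, 0 < r ∧ α < θ ∧ θ < β ∧ x = r * Complex.exp (θ * Complex.I)}

/-! The substitution is well defined: only finitely many `d` contribute to a given coefficient. -/

/-- All exponents of `f` have real part at least `a`. -/
def ReGe (a : ℝ) (f : HahnSeries Expo ℂ) : Prop :=
  ∀ γ, f.coeff γ ≠ 0 → a ≤ (ofLex γ).1

theorem ReGe.mul {a b : ℝ} {f g : HahnSeries Expo ℂ} (hf : ReGe a f) (hg : ReGe b g) :
    ReGe (a + b) (f * g) := by
  intro γ hγ
  obtain ⟨u, hu, v, hv, rfl⟩ := Set.mem_add.1 (HahnSeries.support_mul_subset hγ)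
  exact add_le_add (hf u hu) (hg v hv)

theorem ReGe.one : ReGe 0 1 := by
  intro γ hγ
  rw [HahnSeries.coeff_one] at hγ
  by_cases h : γ = 0
  · subst h; exact le_rfl
  · simp [h] at hγ

theorem ReGe.prod {d : ℕ} {ε : ℝ} (f : Fin d → HahnSeries Expo ℂ) (hf : ∀ k, ReGe ε (f k)) :
    ReGe (d * ε) (∏ k, f k) := by
  induction d with
  | zero => simpa using ReGe.one
  | succ d ih =>
    rw [Fin.prod_univ_succ]
    have := (hf 0).mul (ih (fun k => f k.succ) fun k => hf k.succ)
    convert this using 1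
    push_cast
    ring

theorem support_substCoeff_finite {m : ℕ} (G : (Fin m → ℂ) → ℂ) (Φ : Fin m → HahnSeries Expo ℂ)
    {ε : ℝ} (hε : 0 < ε) (hΦ : ∀ i, ReGe ε (Φ i)) (ν : ℂ) :
    (Function.support fun d : ℕ =>
      (MvPolynomial.aeval Φ (taylorPart G d)).coeff (expo ν)).Finite := by
  obtain ⟨D, hD⟩ := exists_nat_gt (ν.re / ε)
  refine (Set.finite_lt_nat D).subset fun d hd => ?_
  by_contra hlt
  apply hd
  have hDd : (D : ℝ) ≤ d := by exact_mod_cast not_lt.1 hlt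
  have hlt' : ν.re < d * ε := (div_lt_iff₀ hε).1 (hD.trans_le hDd)
  simp only [taylorPart, map_sum, HahnSeries.coeff_sum]
  refine Finset.sum_eq_zero fun i _ => ?_
  rw [map_mul, ← MvPolynomial.algebraMap_eq, AlgHom.commutes, ← Algebra.smul_def,
    HahnSeries.coeff_smul, map_prod]
  simp only [MvPolynomial.aeval_X]
  have h0 : (∏ k, Φ (i k)).coeff (expo ν) = 0 := by
    by_contra hne
    exact absurd (ReGe.prod (fun k => Φ (i k)) (fun k => hΦ (i k)) _ hne) (not_le.2 hlt')
  rw [h0, smul_zero]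

theorem mahlerTuple_re_ge (n ℓ : ℕ) (hℓ : 2 ≤ ℓ) (φ : GenPowerSeries) :
    ∃ ε : ℝ, 0 < ε ∧ ∀ i, ReGe ε (mahlerTuple n ℓ hℓ φ i) := by
  refine ⟨min 1 (φ.exponent 0).re, lt_min one_pos (φ.re_pos 0), ?_⟩
  intro i
  refine Fin.cases ?_ (fun j => ?_) i
  · intro γ hγ
    have : γ = expo 1 := by
      by_contra hne
      exact hγ (by simp [mahlerTuple, monomialX, HahnSeries.coeff_single_of_ne hne])
    subst this
    exact min_le_left _ _
  · have key : ∀ j : ℕ, ReGe (φ.exponent 0).re ((mahlerOp ℓ hℓ)^[j] φ.toHahn) := by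
      intro j
      induction j with
      | zero =>
        intro γ hγ
        obtain ⟨k, hk⟩ : ∃ k, expo (φ.exponent k) = γ := by
          by_contra hne
          push Not at hne
          exact hγ (by simp [GenPowerSeries.toHahn, hne])
        subst hk
        exact φ.re_mono (Nat.zero_le k)
      | succ j ih =>
        rw [Function.iterate_succ_apply']
        intro γ hγ
        have hmem : γ ∈ (expoScale ℓ hℓ) '' ((mahlerOp ℓ hℓ)^[j] φ.toHahn).support := by
          by_contra hne
          exact hγ (HahnSeries.embDomain_notin_image_support hne)
        obtain ⟨δ, hδ, rfl⟩ := hmem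
        have h1 := ih δ hδ
        have h2 : (ofLex (expoScale ℓ hℓ δ)).1 = ℓ * (ofLex δ).1 := by
          change (ofLex (ℓ • δ)).1 = _
          simp
        rw [h2]
        have h3 : (1 : ℝ) ≤ ℓ := by exact_mod_cast (by omega : 1 ≤ ℓ)
        nlinarith [φ.re_pos 0]
    intro γ hγ
    exact (min_le_right _ _).trans (key j γ (by simpa [mahlerTuple] using hγ))

end GenSeries

end

noncomputable section

namespace GenSeries

open scoped ENNReal NNReal

/-! The proof is a majorant argument run by induction on the order of truncation. Put `M = max (Re ν
+ 1) 0`, `t = x^M`, and split `φ = P + t χ` with `P` a finite partial sum and all exponents of `χ`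
of real part at least `1`. Since `ℓ ≥ 2`, replacing `x` by `x^ℓ` turns `t χ` into a multiple of
`t²`. So modulo `t²` the tail enters the tuple only through `y_0`, and Taylor expansion at the tuple
`a` built from `x` and `P` gives `F(Φ) = F(a) + t χ ∂F/∂y_0(a) + t² R`. The derivative at `a` is `A₀
x^ν + H` with `H` of strictly higher order, by at least some `δ > 0`. As `F(Φ) = 0`, division by `A₀
x^ν t` yields a fixed-point equation for `χ`: a term free of `χ`, a term linear in `χ`, and a
remainder, each with a factor of order at least `δ`.

The size of a series is measured by `∑ |c_γ| r^{Re γ}` over `Re γ < s`, with weight `∞` off the cone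
`|Im γ| ≤ K Re γ`. A finite norm thus controls coefficients and directions of exponents together.
Because of the gain `δ`, a bound `η` on `χ` below `s` bounds the right-hand side below `s + δ`. For
small `r` the three terms are at most `η/3` each, so the bound `η` propagates to every `s`
(`exists_bd_of_solution`). The ingredients are the expansion with remainder `taylorSum_expand` and
the estimate `Bd.shift` for multiplication by a monomial.

Hence `∑ |c_k| r^{Re λ_k}` converges and the exponents with nonzero coefficient lie in a cone
(`exists_summable_of_solution`). On a sector the imaginary part of `log x` is bounded
(`exists_abs_im_log_le`), so the cone condition gives `|x^{λ_k}| ≤ r^{Re λ_k}` for small `|x|`, and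
the Weierstrass M-test applies. -/

/-- The real part of an exponent. -/
abbrev reE (γ : Expo) : ℝ := (ofLex γ).1

/-- The imaginary part of an exponent. -/
abbrev imE (γ : Expo) : ℝ := (ofLex γ).2

/-! ### Cones of exponents and truncated weights -/

/-- The cone of exponents `|Im γ| ≤ K Re γ`. -/
def InCone (K : ℝ) (γ : Expo) : Prop := |imE γ| ≤ K * reE γ

theorem InCone.add {K : ℝ} {a b : Expo} (ha : InCone K a) (hb : InCone K b) :
    InCone K (a + b) := by
  have h1 : |imE a + imE b| ≤ |imE a| + |imE b| := abs_add_le _ _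
  have h2 : |imE a + imE b| ≤ K * (reE a + reE b) := by
    have := add_le_add ha hb
    linarith
  exact h2

theorem InCone.nsmul {K : ℝ} {a : Expo} (l : ℕ) (ha : InCone K a) : InCone K (l • a) := by
  induction l with
  | zero => simp [InCone, imE, reE]
  | succ l ih => rw [succ_nsmul]; exact ih.add ha

open Classical in
/-- The weight `r ^ Re γ` on the cone, infinite off the cone, truncated at real part `s`. -/
def wt (K r s : ℝ) (γ : Expo) : ℝ≥0∞ :=
  if s ≤ reE γ then 0 else if InCone K γ then ENNReal.ofReal (r ^ reE γ) else ⊤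

theorem wt_of_le {K r s : ℝ} {γ : Expo} (h : s ≤ reE γ) : wt K r s γ = 0 := by simp [wt, h]

theorem wt_of_lt {K r s : ℝ} {γ : Expo} (h : reE γ < s) (hc : InCone K γ) :
    wt K r s γ = ENNReal.ofReal (r ^ reE γ) := by simp [wt, not_le.2 h, hc]

theorem wt_top {K r s : ℝ} {γ : Expo} (h : reE γ < s) (hc : ¬ InCone K γ) :
    wt K r s γ = ⊤ := by simp [wt, not_le.2 h, hc]

theorem wt_ne_zero {K r s : ℝ} (hr : 0 < r) {γ : Expo} (h : reE γ < s) : wt K r s γ ≠ 0 := by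
  by_cases hc : InCone K γ
  · rw [wt_of_lt h hc]
    simpa using Real.rpow_pos_of_pos hr _
  · simp [wt_top h hc]

/-- A sum `a + b` below `s + δ` with `Re a ≥ δ` forces `Re b < s`. This is the source of the gain:
the second factor need only be known up to `s`. -/
theorem wt_add_le {K r s δ : ℝ} (hr : 0 < r) {a b : Expo} (ha : δ ≤ reE a) (hb : 0 ≤ reE b) :
    wt K r (s + δ) (a + b) ≤ wt K r (s + δ) a * wt K r s b := by
  have hre : reE (a + b) = reE a + reE b := rfl
  by_cases h : s + δ ≤ reE (a + b)
  · rw [wt_of_le h]; exact zero_le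
  have h1 : reE a < s + δ := by rw [hre] at h; linarith
  have h2 : reE b < s := by rw [hre] at h; linarith
  by_cases hca : InCone K a
  · by_cases hcb : InCone K b
    · rw [wt_of_lt (not_le.1 h) (hca.add hcb), wt_of_lt h1 hca, wt_of_lt h2 hcb, hre,
        Real.rpow_add hr, ENNReal.ofReal_mul (Real.rpow_nonneg hr.le _)]
    · rw [wt_top h2 hcb, ENNReal.mul_top (wt_ne_zero hr h1)]
      exact le_top
  · rw [wt_top h1 hca, ENNReal.top_mul (wt_ne_zero hr h2)]
    exact le_top

theorem wt_nsmul_le {K r s : ℝ} (hr : 0 < r) (hr1 : r ≤ 1) {a : Expo} (ha : 0 ≤ reE a) {l : ℕ}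
    (hl : 1 ≤ l) : wt K r s (l • a) ≤ wt K r s a := by
  have hre : reE (l • a) = l * reE a := by simp [reE]
  have hl' : (1 : ℝ) ≤ l := by exact_mod_cast hl
  have hle : reE a ≤ reE (l • a) := by rw [hre]; nlinarith
  by_cases h : s ≤ reE (l • a)
  · rw [wt_of_le h]; exact zero_le
  have h1 : reE a < s := by linarith
  by_cases hca : InCone K a
  · rw [wt_of_lt (not_le.1 h) (hca.nsmul l), wt_of_lt h1 hca]
    exact ENNReal.ofReal_le_ofReal (Real.rpow_le_rpow_of_exponent_ge hr hr1 hle)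
  · rw [wt_top h1 hca]; exact le_top

/-! ### Weighted norms of Hahn series -/

/-- The weighted `ℓ¹` norm of a Hahn series. -/
def wnorm (W : Expo → ℝ≥0∞) (f : HahnSeries Expo ℂ) : ℝ≥0∞ := ∑' γ, ‖f.coeff γ‖ₑ * W γ

theorem wnorm_add_le (W : Expo → ℝ≥0∞) (f g : HahnSeries Expo ℂ) :
    wnorm W (f + g) ≤ wnorm W f + wnorm W g := by
  rw [wnorm, wnorm, wnorm, ← ENNReal.tsum_add]
  refine ENNReal.tsum_le_tsum fun γ => ?_
  rw [← add_mul, HahnSeries.coeff_add]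
  gcongr
  exact enorm_add_le _ _

theorem wnorm_smul (W : Expo → ℝ≥0∞) (c : ℂ) (f : HahnSeries Expo ℂ) :
    wnorm W (c • f) = ‖c‖ₑ * wnorm W f := by
  rw [wnorm, wnorm, ← ENNReal.tsum_mul_left]
  refine tsum_congr fun γ => ?_
  rw [HahnSeries.coeff_smul, smul_eq_mul, enorm_mul, mul_assoc]

theorem wnorm_single (W : Expo → ℝ≥0∞) (τ : Expo) (c : ℂ) :
    wnorm W (HahnSeries.single τ c) = ‖c‖ₑ * W τ := by
  rw [wnorm, tsum_eq_single τ]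
  · simp
  · intro γ hγ
    simp [HahnSeries.coeff_single_of_ne hγ]

/-- The usual `ℓ¹` estimate for convolutions. Three separate weights are allowed so that the factors
may be truncated at different orders. -/
theorem wnorm_mul_le {W W₁ W₂ : Expo → ℝ≥0∞} {f g : HahnSeries Expo ℂ}
    (h : ∀ a b, f.coeff a ≠ 0 → g.coeff b ≠ 0 → W (a + b) ≤ W₁ a * W₂ b) :
    wnorm W (f * g) ≤ wnorm W₁ f * wnorm W₂ g := by
  classical
  have key : ∀ γ, ‖(f * g).coeff γ‖ₑ * W γ ≤ ∑' p : Expo × Expo,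
      if p.1 + p.2 = γ then (‖f.coeff p.1‖ₑ * W₁ p.1) * (‖g.coeff p.2‖ₑ * W₂ p.2) else 0 := by
    intro γ
    rw [HahnSeries.coeff_mul]
    refine (mul_le_mul_left (enorm_sum_le _ _) _).trans ?_
    rw [Finset.sum_mul]
    refine le_trans ?_ (ENNReal.sum_le_tsum
      (Finset.antidiagonal f.isPWO_support g.isPWO_support γ))
    refine Finset.sum_le_sum fun p hp => ?_
    rw [Finset.mem_antidiagonal] at hp
    obtain ⟨h1, h2, h3⟩ := hp
    rw [if_pos h3, enorm_mul, ← h3]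
    calc _ ≤ ‖f.coeff p.1‖ₑ * ‖g.coeff p.2‖ₑ * (W₁ p.1 * W₂ p.2) := by
          gcongr
          exact h _ _ h1 h2
      _ = _ := by ring
  calc wnorm W (f * g) ≤ ∑' γ, ∑' p : Expo × Expo,
      if p.1 + p.2 = γ then (‖f.coeff p.1‖ₑ * W₁ p.1) * (‖g.coeff p.2‖ₑ * W₂ p.2) else 0 :=
        ENNReal.tsum_le_tsum key
    _ = ∑' p : Expo × Expo, (‖f.coeff p.1‖ₑ * W₁ p.1) * (‖g.coeff p.2‖ₑ * W₂ p.2) := by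
        rw [ENNReal.tsum_comm]
        refine tsum_congr fun p => ?_
        rw [tsum_eq_single (p.1 + p.2)]
        · simp
        · intro γ hγ
          rw [if_neg (Ne.symm hγ)]
    _ = wnorm W₁ f * wnorm W₂ g := by
        rw [ENNReal.tsum_prod (f := fun a b => ‖f.coeff a‖ₑ * W₁ a * (‖g.coeff b‖ₑ * W₂ b))]
        simp_rw [ENNReal.tsum_mul_left, ENNReal.tsum_mul_right]
        rfl

theorem wnorm_embDomain (W : Expo → ℝ≥0∞) (e : Expo ↪o Expo) (f : HahnSeries Expo ℂ) :
    wnorm W (HahnSeries.embDomain e f) = wnorm (fun γ => W (e γ)) f := by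
  rw [wnorm, wnorm, ← e.injective.tsum_eq]
  · simp
  · intro γ hγ
    by_contra hne
    exact hγ (by simp [HahnSeries.embDomain_of_notMem_range hne])

theorem wnorm_mono {W₁ W₂ : Expo → ℝ≥0∞} {f : HahnSeries Expo ℂ}
    (h : ∀ γ, f.coeff γ ≠ 0 → W₁ γ ≤ W₂ γ) : wnorm W₁ f ≤ wnorm W₂ f := by
  refine ENNReal.tsum_le_tsum fun γ => ?_
  by_cases h0 : f.coeff γ = 0
  · simp [h0]
  · gcongr
    exact h γ h0

theorem wnorm_wt_eq_zero {K r s : ℝ} {f : HahnSeries Expo ℂ} (h : ReGe s f) :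
    wnorm (wt K r s) f = 0 := by
  refine ENNReal.tsum_eq_zero.2 fun γ => ?_
  by_cases h0 : f.coeff γ = 0
  · simp [h0]
  · rw [wt_of_le (h γ h0), mul_zero]

/-! ### Lower bounds for the real parts of exponents -/

theorem ReGe.mono {a b : ℝ} {f : HahnSeries Expo ℂ} (h : ReGe a f) (hab : b ≤ a) : ReGe b f :=
  fun γ hγ => hab.trans (h γ hγ)

theorem ReGe.zero (a : ℝ) : ReGe a 0 := fun _ hγ => absurd HahnSeries.coeff_zero hγ

theorem ReGe.add {a : ℝ} {f g : HahnSeries Expo ℂ} (hf : ReGe a f) (hg : ReGe a g) :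
    ReGe a (f + g) := by
  intro γ hγ
  by_cases h : f.coeff γ = 0
  · exact hg γ fun h' => hγ (by simp [h, h'])
  · exact hf γ h

theorem ReGe.neg {a : ℝ} {f : HahnSeries Expo ℂ} (hf : ReGe a f) : ReGe a (-f) :=
  fun γ hγ => hf γ fun h => hγ (by simp [h])

theorem ReGe.sub {a : ℝ} {f g : HahnSeries Expo ℂ} (hf : ReGe a f) (hg : ReGe a g) :
    ReGe a (f - g) := by
  rw [sub_eq_add_neg]; exact hf.add hg.neg

theorem ReGe.smul {a : ℝ} (c : ℂ) {f : HahnSeries Expo ℂ} (hf : ReGe a f) : ReGe a (c • f) :=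
  fun γ hγ => hf γ fun h => hγ (by simp [h])

theorem ReGe.sum {ι : Type*} {a : ℝ} (S : Finset ι) (f : ι → HahnSeries Expo ℂ)
    (h : ∀ i ∈ S, ReGe a (f i)) : ReGe a (∑ i ∈ S, f i) :=
  Finset.sum_induction _ _ (fun _ _ => ReGe.add) (ReGe.zero a) h

theorem ReGe.single (τ : Expo) (c : ℂ) : ReGe (reE τ) (HahnSeries.single τ c) := by
  intro γ hγ
  have : γ = τ := by
    by_contra hne
    exact hγ (HahnSeries.coeff_single_of_ne hne)
  rw [this]

/-- If all exponents of a Hahn series have real part greater than `c`, then their real parts are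
bounded below by some number greater than `c`. -/
theorem exists_reGe_of_lt {c : ℝ} {f : HahnSeries Expo ℂ}
    (h : ∀ γ, f.coeff γ ≠ 0 → c < reE γ) : ∃ δ, 0 < δ ∧ ReGe (c + δ) f := by
  by_cases hf : f = 0
  · exact ⟨1, one_pos, hf ▸ ReGe.zero _⟩
  · refine ⟨reE f.order - c, sub_pos.2 (h _ (HahnSeries.coeff_order_eq_zero.not.2 hf)),
      fun _ hγ => ?_⟩
    rw [add_sub_cancel]
    exact Prod.Lex.monotone_fst _ _ (HahnSeries.order_le_of_coeff_ne_zero hγ)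

/-! ### Calculus of truncated norm bounds -/

/-- All exponents of `f` have nonnegative real part, and the truncated norm of `f` is at most
`b`. -/
def Bd (K r s : ℝ) (f : HahnSeries Expo ℂ) (b : ℝ≥0) : Prop :=
  ReGe 0 f ∧ wnorm (wt K r s) f ≤ b

section Bd

variable {K r s : ℝ} {f g : HahnSeries Expo ℂ} {b c : ℝ≥0}

theorem Bd.mono (h : Bd K r s f b) (hbc : b ≤ c) : Bd K r s f c :=
  ⟨h.1, h.2.trans (by exact_mod_cast hbc)⟩

theorem Bd.zero : Bd K r s 0 0 := ⟨ReGe.zero 0, by simp [wnorm]⟩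

theorem Bd.add (hf : Bd K r s f b) (hg : Bd K r s g c) : Bd K r s (f + g) (b + c) :=
  ⟨hf.1.add hg.1, (wnorm_add_le _ _ _).trans (by push_cast; exact add_le_add hf.2 hg.2)⟩

theorem Bd.smul (z : ℂ) (hf : Bd K r s f b) : Bd K r s (z • f) (‖z‖₊ * b) :=
  ⟨hf.1.smul z, by
    rw [wnorm_smul, ENNReal.coe_mul]
    exact mul_le_mul' le_rfl hf.2⟩

theorem Bd.mul_gain {δ : ℝ} (hr : 0 < r) (hδ : 0 ≤ δ) (hf : Bd K r (s + δ) f b)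
    (hfδ : ReGe δ f) (hg : Bd K r s g c) : Bd K r (s + δ) (f * g) (b * c) := by
  refine ⟨(hfδ.mul hg.1).mono (by linarith), ?_⟩
  rw [ENNReal.coe_mul]
  exact (wnorm_mul_le fun u v hu hv => wt_add_le hr (hfδ u hu) (hg.1 v hv)).trans
    (mul_le_mul' hf.2 hg.2)

theorem Bd.mul (hr : 0 < r) (hf : Bd K r s f b) (hg : Bd K r s g c) :
    Bd K r s (f * g) (b * c) := by
  have := Bd.mul_gain (s := s) (δ := 0) (K := K) hr le_rfl (by simpa using hf) hf.1 hg
  simpa using this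

theorem Bd.sum {ι : Type*} (S : Finset ι) {f : ι → HahnSeries Expo ℂ} {b : ι → ℝ≥0}
    (h : ∀ i ∈ S, Bd K r s (f i) (b i)) : Bd K r s (∑ i ∈ S, f i) (∑ i ∈ S, b i) := by
  classical
  induction S using Finset.induction_on with
  | empty => simpa using Bd.zero
  | insert i S hi ih =>
    rw [Finset.sum_insert hi, Finset.sum_insert hi]
    exact (h i (Finset.mem_insert_self _ _)).add
      (ih fun j hj => h j (Finset.mem_insert_of_mem hj))

theorem Bd.single {τ : Expo} (z : ℂ) (hτ0 : 0 ≤ reE τ) (hτ : InCone K τ) :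
    Bd K r s (HahnSeries.single τ z) (‖z‖₊ * (r ^ reE τ).toNNReal) := by
  refine ⟨(ReGe.single τ z).mono hτ0, ?_⟩
  rw [wnorm_single, ENNReal.coe_mul]
  refine mul_le_mul' le_rfl ?_
  by_cases h : s ≤ reE τ
  · rw [wt_of_le h]; exact zero_le
  · rw [wt_of_lt (not_le.1 h) hτ]; rfl

theorem Bd.one : Bd K r s 1 1 := by
  have := Bd.single (K := K) (r := r) (s := s) (τ := 0) 1 le_rfl (by simp [InCone, imE, reE])
  simpa [reE] using this

theorem Bd.prod {d : ℕ} (hr : 0 < r) {f : Fin d → HahnSeries Expo ℂ} {b : Fin d → ℝ≥0}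
    (h : ∀ i, Bd K r s (f i) (b i)) : Bd K r s (∏ i, f i) (∏ i, b i) := by
  induction d with
  | zero => simpa using Bd.one
  | succ d ih =>
    rw [Fin.prod_univ_succ, Fin.prod_univ_succ]
    exact (h 0).mul hr (ih fun i => h i.succ)

theorem Bd.mahlerOp {l : ℕ} (hl : 2 ≤ l) (hr : 0 < r) (hr1 : r ≤ 1) (h : Bd K r s f b) :
    Bd K r s (mahlerOp l hl f) b := by
  constructor
  · intro γ hγ
    have hmem : γ ∈ (expoScale l hl) '' f.support := by
      by_contra hne
      exact hγ (HahnSeries.embDomain_notin_image_support hne)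
    obtain ⟨a, ha, rfl⟩ := hmem
    have h2 : reE (expoScale l hl a) = l * reE a := by
      change (ofLex (l • a)).1 = _
      simp
    have h3 := h.1 a ha
    change 0 ≤ reE (expoScale l hl a)
    rw [h2]
    positivity
  · rw [GenSeries.mahlerOp, wnorm_embDomain]
    refine le_trans (wnorm_mono fun γ hγ => ?_) h.2
    exact wt_nsmul_le hr hr1 (h.1 γ hγ) (by omega)

end Bd

/-! ### Taylor coefficients of an analytic function -/

theorem hahn_mul_smul (c : ℂ) (f g : HahnSeries Expo ℂ) : f * c • g = c • (f * g) := by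
  rw [← HahnSeries.single_zero_mul_eq_smul, ← HahnSeries.single_zero_mul_eq_smul, mul_left_comm]

/-- The coefficient of `X_{i_1} ⋯ X_{i_d}` in the definition of `taylorPart`. -/
def taylorCoeff {m : ℕ} (G : (Fin m → ℂ) → ℂ) (d : ℕ) (i : Fin d → Fin m) : ℂ :=
  (d.factorial : ℂ)⁻¹ * iteratedFDeriv ℂ d G 0 fun k => Pi.single (i k) (1 : ℂ)

theorem aeval_taylorPart {m : ℕ} (G : (Fin m → ℂ) → ℂ) (d : ℕ)
    (Φ : Fin m → HahnSeries Expo ℂ) :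
    MvPolynomial.aeval Φ (taylorPart G d) =
      ∑ i : Fin d → Fin m, taylorCoeff G d i • ∏ k, Φ (i k) := by
  rw [taylorPart, map_sum]
  refine Finset.sum_congr rfl fun i _ => ?_
  rw [map_mul, ← MvPolynomial.algebraMap_eq, AlgHom.commutes, ← Algebra.smul_def, map_prod]
  simp only [MvPolynomial.aeval_X]
  rfl

/-- The iterated derivative is the sum of the `d`-th power series term over all `d!` permutations of
its arguments. The factor `1 / d!` cancels their number, and the terms grow geometrically inside the
radius of convergence. -/
theorem exists_taylorCoeff_le {m : ℕ} {G : (Fin m → ℂ) → ℂ} (hG : AnalyticAt ℂ G 0) :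
    ∃ C a : ℝ≥0, 0 < C ∧ 0 < a ∧ ∀ d i, ‖taylorCoeff G d i‖₊ ≤ C * a ^ d := by
  obtain ⟨p, ρ, hp⟩ := hG
  obtain ⟨C, a, hC, ha, hbound⟩ := p.le_mul_pow_of_radius_pos (hp.r_pos.trans_le hp.r_le)
  refine ⟨⟨C, hC.le⟩, ⟨a, ha.le⟩, hC, ha, fun d i => ?_⟩
  change ‖taylorCoeff G d i‖ ≤ C * a ^ d
  rw [taylorCoeff, hp.iteratedFDeriv_eq_sum_of_completeSpace, norm_mul, norm_inv]
  have hfac : (0 : ℝ) < d.factorial := by exact_mod_cast d.factorial_pos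
  have h1 : ‖(d.factorial : ℂ)‖ = d.factorial := by simp
  rw [h1, inv_mul_le_iff₀ hfac]
  refine (norm_sum_le _ _).trans ?_
  refine (Finset.sum_le_card_nsmul _ _ (C * a ^ d) fun σ _ => ?_).trans ?_
  · refine ((p d).le_opNorm _).trans ?_
    have h2 : ∏ k, ‖(Pi.single (i (σ k)) (1 : ℂ) : Fin m → ℂ)‖ = 1 :=
      Finset.prod_eq_one fun k _ => by simp [Pi.norm_single]
    rw [h2, mul_one]
    exact hbound d
  · simp [Fintype.card_perm]

theorem analyticAt_partialY0 {n : ℕ} {F : (Fin (n + 2) → ℂ) → ℂ} (hF : AnalyticAt ℂ F 0) :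
    AnalyticAt ℂ (partialY0 F) 0 :=
  ((ContinuousLinearMap.apply ℂ ℂ (Pi.single 1 1 : Fin (n + 2) → ℂ)).analyticAt _).comp
    hF.fderiv

/-- By symmetry of higher derivatives the slot carrying the index of `y_0` is irrelevant; the factor
`d + 1` is `(d + 1)! / d!`. -/
theorem taylorCoeff_partialY0 {n : ℕ} {F : (Fin (n + 2) → ℂ) → ℂ} (hF : AnalyticAt ℂ F 0)
    (d : ℕ) (k : Fin (d + 1)) (i : Fin d → Fin (n + 2)) :
    taylorCoeff (partialY0 F) d i =
      ((d + 1 : ℕ) : ℂ) * taylorCoeff F (d + 1) (Fin.insertNth k (1 : Fin (n + 2)) i) := by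
  have hsymm : ∀ (k : Fin (d + 1)), taylorCoeff F (d + 1) (Fin.insertNth k (1 : Fin (n + 2)) i) =
      taylorCoeff F (d + 1) (Fin.cons (1 : Fin (n + 2)) i) := by
    intro k
    rw [← Fin.cons_comp_cycleRange, taylorCoeff, taylorCoeff]
    congr 1
    exact (hF.contDiffAt (n := ⊤)).iteratedFDeriv_comp_perm
      (fun j => Pi.single ((Fin.cons (1 : Fin (n + 2)) i : Fin (d + 1) → Fin (n + 2)) j) (1 : ℂ))
      k.cycleRange
  rw [hsymm k, ← hsymm (Fin.last d), Fin.insertNth_last', taylorCoeff, taylorCoeff,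
    iteratedFDeriv_succ_apply_right]
  have hcomp : partialY0 F =
      (ContinuousLinearMap.apply ℂ ℂ (Pi.single 1 1 : Fin (n + 2) → ℂ)) ∘
        fun y => fderiv ℂ F y := rfl
  rw [hcomp, ContinuousLinearMap.iteratedFDeriv_comp_left (n := ⊤) _ hF.fderiv.contDiffAt
    le_top]
  have hfac : ((d + 1).factorial : ℂ) = ((d + 1 : ℕ) : ℂ) * d.factorial := by
    rw [Nat.factorial_succ]; push_cast; ring
  have h1 : ((d + 1 : ℕ) : ℂ) ≠ 0 := by exact_mod_cast d.succ_ne_zero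
  have h2 : (Fin.init fun j : Fin (d + 1) =>
      (Pi.single ((Fin.snoc i 1 : Fin (d + 1) → Fin (n + 2)) j) (1 : ℂ) : Fin (n + 2) → ℂ)) =
      fun j => Pi.single (i j) 1 := by
    funext j
    simp [Fin.init]
  rw [h2, hfac, mul_inv, ← mul_assoc, ← mul_assoc, mul_inv_cancel₀ h1, one_mul]
  simp

/-! ### Taylor expansion to second order in `t` -/

section Expansion

variable {K r s : ℝ}

/-- All terms of the expanded product have nonnegative majorants and `t` has norm at most `1`. So
the majorants of the three parts sum to at most the full product of the majorants, which makes the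
later geometric summation possible. -/
theorem prod_expand {ι : Type*} [DecidableEq ι] (hr : 0 < r) (S : Finset ι)
    {a b c : ι → HahnSeries Expo ℂ} {t : HahnSeries Expo ℂ} {α β γ : ι → ℝ≥0}
    (ht : Bd K r s t 1) (ha : ∀ i, Bd K r s (a i) (α i)) (hb : ∀ i, Bd K r s (b i) (β i))
    (hc : ∀ i, Bd K r s (c i) (γ i)) :
    ∃ R, ∏ i ∈ S, (a i + t * b i + t ^ 2 * c i) =
        ∏ i ∈ S, a i + t * ∑ k ∈ S, b k * ∏ i ∈ S.erase k, a i + t ^ 2 * R ∧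
      ∃ p q u : ℝ≥0, Bd K r s (∏ i ∈ S, a i) p ∧
        Bd K r s (∑ k ∈ S, b k * ∏ i ∈ S.erase k, a i) q ∧ Bd K r s R u ∧
        p + q + u ≤ ∏ i ∈ S, (α i + β i + γ i) := by
  induction S using Finset.induction_on with
  | empty => exact ⟨0, by simp, 1, 0, 0, by simpa using Bd.one, by simpa using Bd.zero,
      Bd.zero, by simp⟩
  | insert x S hx ih =>
    obtain ⟨R, hR, p, q, u, hp, hq, hu, hle⟩ := ih
    have hL : ∑ k ∈ insert x S, b k * ∏ i ∈ (insert x S).erase k, a i =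
        b x * ∏ i ∈ S, a i + a x * ∑ k ∈ S, b k * ∏ i ∈ S.erase k, a i := by
      rw [Finset.sum_insert hx, Finset.erase_insert hx, Finset.mul_sum]
      congr 1
      refine Finset.sum_congr rfl fun k hk => ?_
      have hne : x ≠ k := fun h => hx (h ▸ hk)
      rw [Finset.erase_insert_of_ne hne, Finset.prod_insert
        (fun h => hx (Finset.mem_of_mem_erase h))]
      ring
    rw [hL, Finset.prod_insert hx, Finset.prod_insert hx, Finset.prod_insert hx, hR]
    set A := ∏ i ∈ S, a i
    set L := ∑ k ∈ S, b k * ∏ i ∈ S.erase k, a i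
    refine ⟨a x * R + b x * L + c x * A + t * (b x * R + c x * L) + t * (t * (c x * R)),
      by ring, α x * p, β x * p + α x * q,
      α x * u + β x * q + γ x * p + 1 * (β x * u + γ x * q) + 1 * (1 * (γ x * u)),
      (ha x).mul hr hp, ((hb x).mul hr hp).add ((ha x).mul hr hq), ?_, ?_⟩
    · exact (((((ha x).mul hr hu).add ((hb x).mul hr hq)).add ((hc x).mul hr hp)).add
        (ht.mul hr (((hb x).mul hr hu).add ((hc x).mul hr hq)))).add
        (ht.mul hr (ht.mul hr ((hc x).mul hr hu)))
    · calc _ = (α x + β x + γ x) * (p + q + u) := by ring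
        _ ≤ _ := by gcongr

theorem aeval_taylorPart_bd {m : ℕ} {G : (Fin m → ℂ) → ℂ} {C A : ℝ≥0}
    (hbound : ∀ d i, ‖taylorCoeff G d i‖₊ ≤ C * A ^ d) (hr : 0 < r)
    {a : Fin m → HahnSeries Expo ℂ} {α : Fin m → ℝ≥0} (ha : ∀ i, Bd K r s (a i) (α i)) (d : ℕ) :
    Bd K r s (MvPolynomial.aeval a (taylorPart G d)) (C * (A * ∑ i, α i) ^ d) := by
  rw [aeval_taylorPart]
  refine (Bd.sum Finset.univ fun i _ =>
    Bd.smul (taylorCoeff G d i) (Bd.prod hr fun k => ha (i k))).mono ?_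
  rw [mul_pow, Fintype.sum_pow, ← mul_assoc, Finset.mul_sum]
  exact Finset.sum_le_sum fun i _ => mul_le_mul' (hbound d i) le_rfl

/-- Only index tuples with `1` in slot `k` survive. Each of the `d + 1` slots contributes the same
amount, which cancels the factor `d + 1` of `taylorCoeff_partialY0`. -/
theorem sum_linear_part {n : ℕ} {F : (Fin (n + 2) → ℂ) → ℂ} (hF : AnalyticAt ℂ F 0)
    (a : Fin (n + 2) → HahnSeries Expo ℂ) (χ : HahnSeries Expo ℂ) (d : ℕ) :
    ∑ i : Fin (d + 1) → Fin (n + 2), taylorCoeff F (d + 1) i •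
        ∑ k, (Pi.single 1 χ : Fin (n + 2) → HahnSeries Expo ℂ) (i k) *
          ∏ j ∈ Finset.univ.erase k, a (i j) =
      χ * MvPolynomial.aeval a (taylorPart (partialY0 F) d) := by
  simp_rw [Finset.smul_sum]
  rw [Finset.sum_comm]
  have hk : ∀ k : Fin (d + 1), ∑ i : Fin (d + 1) → Fin (n + 2), taylorCoeff F (d + 1) i •
      ((Pi.single 1 χ : Fin (n + 2) → HahnSeries Expo ℂ) (i k) *
        ∏ j ∈ Finset.univ.erase k, a (i j)) =
      ((d + 1 : ℕ) : ℂ)⁻¹ • (χ * MvPolynomial.aeval a (taylorPart (partialY0 F) d)) := by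
    intro k
    rw [← (Fin.insertNthEquiv (fun _ => Fin (n + 2)) k).sum_comp, Fintype.sum_prod_type,
      Finset.sum_eq_single (1 : Fin (n + 2))]
    · rw [aeval_taylorPart, Finset.mul_sum, Finset.smul_sum]
      refine Finset.sum_congr rfl fun i _ => ?_
      have hprod : ∏ j ∈ Finset.univ.erase k,
          a ((Fin.insertNth k (1 : Fin (n + 2)) i : Fin (d + 1) → Fin (n + 2)) j) =
          ∏ j, a (i j) := by
        rw [Fin.univ_succAbove d k, Finset.erase_cons, Finset.prod_map]
        simp
      have h1 : ((d + 1 : ℕ) : ℂ) ≠ 0 := by exact_mod_cast d.succ_ne_zero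
      rw [taylorCoeff_partialY0 hF d k i, hahn_mul_smul, smul_smul, ← mul_assoc,
        inv_mul_cancel₀ h1, one_mul]
      change _ • ((Pi.single 1 χ : Fin (n + 2) → HahnSeries Expo ℂ)
        ((Fin.insertNth k (1 : Fin (n + 2)) i : Fin (d + 1) → Fin (n + 2)) k) *
          ∏ j ∈ Finset.univ.erase k,
            a ((Fin.insertNth k (1 : Fin (n + 2)) i : Fin (d + 1) → Fin (n + 2)) j)) = _
      rw [hprod, Fin.insertNth_apply_same, Pi.single_eq_same]
      rfl
    · intro x _ hx
      refine Finset.sum_eq_zero fun i _ => ?_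
      simp [Pi.single_eq_of_ne hx]
    · simp
  rw [Finset.sum_congr rfl fun k _ => hk k, Finset.sum_const, Finset.card_univ, Fintype.card_fin,
    ← Nat.cast_smul_eq_nsmul ℂ, smul_smul, mul_inv_cancel₀ (by exact_mod_cast d.succ_ne_zero),
    one_smul]

theorem taylorPart_expand {n : ℕ} {F : (Fin (n + 2) → ℂ) → ℂ} (hF : AnalyticAt ℂ F 0)
    {C A : ℝ≥0} (hbound : ∀ d i, ‖taylorCoeff F d i‖₊ ≤ C * A ^ d) (hr : 0 < r)
    {a c : Fin (n + 2) → HahnSeries Expo ℂ} {χ t : HahnSeries Expo ℂ}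
    {α β γ : Fin (n + 2) → ℝ≥0} (ht : Bd K r s t 1) (ha : ∀ i, Bd K r s (a i) (α i))
    (hb : ∀ i, Bd K r s ((Pi.single 1 χ : Fin (n + 2) → HahnSeries Expo ℂ) i) (β i))
    (hc : ∀ i, Bd K r s (c i) (γ i)) (d : ℕ) :
    ∃ R, MvPolynomial.aeval
          (fun i => a i + t * (Pi.single 1 χ : Fin (n + 2) → HahnSeries Expo ℂ) i + t ^ 2 * c i)
          (taylorPart F (d + 1)) =
        MvPolynomial.aeval a (taylorPart F (d + 1)) +
          t * (χ * MvPolynomial.aeval a (taylorPart (partialY0 F) d)) + t ^ 2 * R ∧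
      Bd K r s R (C * (A * ∑ i, (α i + β i + γ i)) ^ (d + 1)) := by
  have h : ∀ i : Fin (d + 1) → Fin (n + 2), ∃ R,
      ∏ k, (a (i k) + t * (Pi.single 1 χ : Fin (n + 2) → HahnSeries Expo ℂ) (i k) +
        t ^ 2 * c (i k)) =
      ∏ k, a (i k) + t * ∑ k, (Pi.single 1 χ : Fin (n + 2) → HahnSeries Expo ℂ) (i k) *
          ∏ j ∈ Finset.univ.erase k, a (i j) + t ^ 2 * R ∧
      Bd K r s R (∏ k, (α (i k) + β (i k) + γ (i k))) := by
    intro i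
    obtain ⟨R, hR, p, q, u, -, -, hu, hle⟩ := prod_expand hr Finset.univ ht
      (fun k => ha (i k)) (fun k => hb (i k)) (fun k => hc (i k))
    exact ⟨R, hR, hu.mono (le_add_self.trans hle)⟩
  choose R hR hRb using h
  refine ⟨∑ i, taylorCoeff F (d + 1) i • R i, ?_, ?_⟩
  · rw [← sum_linear_part hF, aeval_taylorPart, aeval_taylorPart, Finset.mul_sum, Finset.mul_sum,
      ← Finset.sum_add_distrib, ← Finset.sum_add_distrib]
    refine Finset.sum_congr rfl fun i _ => ?_
    rw [hR i, smul_add, smul_add, hahn_mul_smul, hahn_mul_smul]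
  · refine (Bd.sum Finset.univ fun i _ => (hRb i).smul (taylorCoeff F (d + 1) i)).mono ?_
    rw [mul_pow, Fintype.sum_pow, ← mul_assoc, Finset.mul_sum]
    exact Finset.sum_le_sum fun i _ => mul_le_mul' (hbound _ i) le_rfl

/-- The Taylor polynomial of degree less than `D`, evaluated at a tuple of Hahn series. -/
def taylorSum {m : ℕ} (G : (Fin m → ℂ) → ℂ) (D : ℕ) (Φ : Fin m → HahnSeries Expo ℂ) :
    HahnSeries Expo ℂ :=
  ∑ d ∈ Finset.range D, MvPolynomial.aeval Φ (taylorPart G d)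

theorem sum_geometric_half_le {q : ℝ≥0} (hq : q ≤ 2⁻¹) (D : ℕ) :
    ∑ d ∈ Finset.range D, q ^ d ≤ 2 := by
  have h : ∀ D, ∑ d ∈ Finset.range D, (2⁻¹ : ℝ≥0) ^ d ≤ 2 := by
    intro D
    have := Summable.sum_le_tsum (f := fun d : ℕ => ((2 : ℝ)⁻¹) ^ d) (Finset.range D)
      (fun _ _ => by positivity) (summable_geometric_of_lt_one (by norm_num) (by norm_num))
    rw [tsum_geometric_inv_two] at this
    rw [← NNReal.coe_le_coe]
    push_cast
    exact this
  exact (Finset.sum_le_sum fun d _ => pow_le_pow_left' hq d).trans (h D)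

theorem taylorSum_bd {m : ℕ} {G : (Fin m → ℂ) → ℂ} {C A : ℝ≥0}
    (hbound : ∀ d i, ‖taylorCoeff G d i‖₊ ≤ C * A ^ d) (hr : 0 < r)
    {a : Fin m → HahnSeries Expo ℂ} {α : Fin m → ℝ≥0} (ha : ∀ i, Bd K r s (a i) (α i))
    (hα : A * ∑ i, α i ≤ 2⁻¹) (D : ℕ) :
    Bd K r s (taylorSum G D a) (C * 2) := by
  refine (Bd.sum _ fun d _ => aeval_taylorPart_bd hbound hr ha d).mono ?_
  rw [← Finset.mul_sum]
  exact mul_le_mul' le_rfl (sum_geometric_half_le hα D)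

/-- With geometric ratio at most `1/2`, the remainder bound is independent of `D`. Differentiation
lowers the degree by one, hence `D + 1` for `F` against `D` for its derivative. -/
theorem taylorSum_expand {n : ℕ} {F : (Fin (n + 2) → ℂ) → ℂ} (hF : AnalyticAt ℂ F 0)
    {C A : ℝ≥0} (hbound : ∀ d i, ‖taylorCoeff F d i‖₊ ≤ C * A ^ d) (hr : 0 < r)
    {a c : Fin (n + 2) → HahnSeries Expo ℂ} {χ t : HahnSeries Expo ℂ}
    {α β γ : Fin (n + 2) → ℝ≥0} (ht : Bd K r s t 1) (ha : ∀ i, Bd K r s (a i) (α i))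
    (hb : ∀ i, Bd K r s ((Pi.single 1 χ : Fin (n + 2) → HahnSeries Expo ℂ) i) (β i))
    (hc : ∀ i, Bd K r s (c i) (γ i)) (hα : A * ∑ i, (α i + β i + γ i) ≤ 2⁻¹) (D : ℕ) :
    ∃ R, taylorSum F (D + 1)
          (fun i => a i + t * (Pi.single 1 χ : Fin (n + 2) → HahnSeries Expo ℂ) i + t ^ 2 * c i) =
        taylorSum F (D + 1) a + t * (χ * taylorSum (partialY0 F) D a) + t ^ 2 * R ∧
      Bd K r s R (C * 2) := by
  choose R hR hRb using fun d => taylorPart_expand hF hbound hr ht ha hb hc d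
  refine ⟨∑ d ∈ Finset.range D, R d, ?_, ?_⟩
  · have h0 : ∀ Ψ : Fin (n + 2) → HahnSeries Expo ℂ, MvPolynomial.aeval Ψ (taylorPart F 0) =
        MvPolynomial.aeval a (taylorPart F 0) := by
      intro Ψ; simp [aeval_taylorPart]
    simp only [taylorSum]
    rw [Finset.sum_range_succ', Finset.sum_range_succ' _ D, h0,
      Finset.sum_congr rfl fun d _ => hR d]
    simp only [Finset.mul_sum, Finset.sum_add_distrib]
    abel
  · refine (Bd.sum _ fun d _ => hRb d).mono ?_
    rw [← Finset.mul_sum]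
    refine mul_le_mul' le_rfl (le_trans ?_ (sum_geometric_half_le hα (D + 1)))
    rw [Finset.sum_range_succ']
    exact le_self_add

end Expansion

/-! ### Taylor polynomials and the formal substitution -/

theorem expo_mk (γ : Expo) : expo ⟨reE γ, imE γ⟩ = γ := rfl

theorem ReGe.aeval_taylorPart {m : ℕ} (G : (Fin m → ℂ) → ℂ) {Φ : Fin m → HahnSeries Expo ℂ}
    {ε : ℝ} (hΦ : ∀ i, ReGe ε (Φ i)) (d : ℕ) :
    ReGe (d * ε) (MvPolynomial.aeval Φ (taylorPart G d)) := by
  rw [GenSeries.aeval_taylorPart]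
  exact ReGe.sum _ _ fun i _ => (ReGe.prod (fun k => Φ (i k)) fun k => hΦ (i k)).smul _

theorem coeff_taylorSum {m : ℕ} (G : (Fin m → ℂ) → ℂ) {Φ : Fin m → HahnSeries Expo ℂ}
    {ε : ℝ} (hε : 0 < ε) (hΦ : ∀ i, ReGe ε (Φ i)) {D : ℕ} {κ : ℂ} (hκ : κ.re < D * ε) :
    (taylorSum G D Φ).coeff (expo κ) = substCoeff G Φ κ := by
  rw [substCoeff, taylorSum, HahnSeries.coeff_sum, finsum_eq_sum_of_support_subset]
  intro d hd
  rw [Finset.coe_range, Set.mem_Iio]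
  by_contra hlt
  have h1 : (D : ℝ) ≤ d := by exact_mod_cast not_lt.1 hlt
  have h2 : (d : ℝ) * ε ≤ κ.re := ReGe.aeval_taylorPart G hΦ d _ hd
  nlinarith

theorem ReGe.taylorSum_sub {m : ℕ} (G : (Fin m → ℂ) → ℂ) {Φ : Fin m → HahnSeries Expo ℂ}
    {ε : ℝ} (hε : 0 < ε) (hΦ : ∀ i, ReGe ε (Φ i)) {D D' : ℕ} (h : D ≤ D') :
    ReGe (D * ε) (taylorSum G D' Φ - taylorSum G D Φ) := by
  rw [taylorSum, taylorSum, ← Finset.sum_range_add_sum_Ico _ h, add_sub_cancel_left]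
  refine ReGe.sum _ _ fun d hd => (ReGe.aeval_taylorPart G hΦ d).mono ?_
  have : (D : ℝ) ≤ d := by exact_mod_cast (Finset.mem_Ico.1 hd).1
  nlinarith

theorem ReGe.prod_sub {M : ℝ} {d : ℕ} {f g : Fin d → HahnSeries Expo ℂ}
    (hf : ∀ k, ReGe 0 (f k)) (hg : ∀ k, ReGe 0 (g k)) (hfg : ∀ k, ReGe M (f k - g k)) :
    ReGe M (∏ k, f k - ∏ k, g k) := by
  induction d with
  | zero => simpa using ReGe.zero M
  | succ d ih =>
    rw [Fin.prod_univ_succ, Fin.prod_univ_succ]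
    have h1 := ih (fun k => hf k.succ) (fun k => hg k.succ) fun k => hfg k.succ
    have h2 : ReGe 0 (∏ k : Fin d, g k.succ) := by
      simpa using ReGe.prod (fun k : Fin d => g k.succ) fun k => hg k.succ
    have h3 := ((hf 0).mul h1).add (((hfg 0).mul h2).mono (b := 0 + M) (by linarith))
    rw [zero_add] at h3
    convert h3 using 1
    ring

theorem ReGe.taylorSum_congr {m : ℕ} (G : (Fin m → ℂ) → ℂ) {Φ Ψ : Fin m → HahnSeries Expo ℂ}
    {M : ℝ} (hΦ : ∀ i, ReGe 0 (Φ i)) (hΨ : ∀ i, ReGe 0 (Ψ i)) (h : ∀ i, ReGe M (Φ i - Ψ i))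
    (D : ℕ) : ReGe M (taylorSum G D Φ - taylorSum G D Ψ) := by
  rw [taylorSum, taylorSum, ← Finset.sum_sub_distrib]
  refine ReGe.sum _ _ fun d _ => ?_
  rw [GenSeries.aeval_taylorPart, GenSeries.aeval_taylorPart, ← Finset.sum_sub_distrib]
  refine ReGe.sum _ _ fun i _ => ?_
  rw [← HahnSeries.single_zero_mul_eq_smul, ← HahnSeries.single_zero_mul_eq_smul, ← mul_sub,
    HahnSeries.single_zero_mul_eq_smul]
  exact (ReGe.prod_sub (fun k => hΦ (i k)) (fun k => hΨ (i k)) fun k => h (i k)).smul _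

/-! ### Change of cone and radius, multiplication by monomials -/

theorem InCone.mono {K K' : ℝ} (hK : K ≤ K') {γ : Expo} (hγ : 0 ≤ reE γ) (h : InCone K γ) :
    InCone K' γ := by
  have h' : |imE γ| ≤ K * reE γ := h
  change |imE γ| ≤ K' * reE γ
  nlinarith

theorem Bd.mono_weight {K K' r r' s : ℝ} {f : HahnSeries Expo ℂ} {b : ℝ≥0} (hK : K ≤ K')
    (hr : 0 < r) (hrr : r ≤ r') (h : Bd K r' s f b) : Bd K' r s f b := by
  refine ⟨h.1, (wnorm_mono fun γ hγ => ?_).trans h.2⟩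
  by_cases hs : s ≤ reE γ
  · rw [wt_of_le hs]; exact zero_le
  by_cases hc : InCone K γ
  · rw [wt_of_lt (not_le.1 hs) hc, wt_of_lt (not_le.1 hs) (hc.mono hK (h.1 γ hγ))]
    exact ENNReal.ofReal_le_ofReal (Real.rpow_le_rpow hr.le hrr (h.1 γ hγ))
  · rw [wt_top (not_le.1 hs) hc]; exact le_top

/-- Translation by `τ` may leave the old cone, but only by the bounded amount `E = K₀ |Re τ| + |Im
τ|`. As the resulting real part `q` is at least `δ`, `E ≤ (E / δ) q` and a wider cone absorbs it.
Likewise `(r / r₀)^q ≤ (r / r₀)^δ`. -/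
theorem wt_shift_le {K₀ K r₀ r s δ : ℝ} {τ γ : Expo} (hK₀ : 0 ≤ K₀) (hr : 0 < r) (hrr : r ≤ r₀)
    (hδ : 0 < δ) (hK : K₀ + (K₀ * |reE τ| + |imE τ|) / δ ≤ K) (h : δ ≤ reE (τ + γ)) :
    wt K r s (τ + γ) ≤
      ENNReal.ofReal ((r / r₀) ^ δ * r₀ ^ reE τ) * wt K₀ r₀ (s - reE τ) γ := by
  have hre : reE (τ + γ) = reE τ + reE γ := rfl
  have him : imE (τ + γ) = imE τ + imE γ := rfl
  have hr₀ : 0 < r₀ := hr.trans_le hrr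
  have hB : 0 < (r / r₀) ^ δ * r₀ ^ reE τ := by positivity
  by_cases hs : s ≤ reE (τ + γ)
  · rw [wt_of_le hs]; exact zero_le
  have hs' : reE γ < s - reE τ := by rw [hre] at hs; linarith
  by_cases hc : InCone K₀ γ
  · have hc' : InCone K (τ + γ) := by
      have h0 : |imE γ| ≤ K₀ * reE γ := hc
      change |imE (τ + γ)| ≤ K * reE (τ + γ)
      set q := reE (τ + γ) with hq
      have hγq : reE γ = q - reE τ := by rw [hre]; ring
      have h1 : |imE (τ + γ)| ≤ |imE τ| + |imE γ| := by rw [him]; exact abs_add_le _ _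
      set E := K₀ * |reE τ| + |imE τ| with hE
      have hE0 : 0 ≤ E := by positivity
      have h2 : E ≤ E / δ * q := by
        rw [div_mul_eq_mul_div, le_div_iff₀ hδ]
        exact mul_le_mul_of_nonneg_left h hE0
      have h3 : K₀ * reE γ ≤ K₀ * q + K₀ * |reE τ| := by
        rw [hγq]
        nlinarith [neg_abs_le (reE τ)]
      have h4 : (K₀ + E / δ) * q ≤ K * q := mul_le_mul_of_nonneg_right hK (hδ.le.trans h)
      nlinarith
    rw [wt_of_lt (not_le.1 hs) hc', wt_of_lt hs' hc, ← ENNReal.ofReal_mul hB.le]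
    refine ENNReal.ofReal_le_ofReal ?_
    have hq : r ^ reE (τ + γ) = (r / r₀) ^ reE (τ + γ) * (r₀ ^ reE τ * r₀ ^ reE γ) := by
      rw [← Real.rpow_add hr₀, ← hre, ← Real.mul_rpow (by positivity) hr₀.le,
        div_mul_cancel₀ _ hr₀.ne']
    rw [hq, mul_assoc]
    refine mul_le_mul_of_nonneg_right ?_ (by positivity)
    exact Real.rpow_le_rpow_of_exponent_ge (by positivity) ((div_le_one hr₀).2 hrr) h
  · rw [wt_top hs' hc, ENNReal.mul_top (by simpa using hB)]
    exact le_top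

/-- Here `Re τ` may be negative, so this is the tool for dividing by `x^ν`. The norm of `f` is taken
at a fixed radius `r₀`, and `(r / r₀)^δ` makes the product small as `r → 0`. -/
theorem Bd.shift {K₀ K r₀ r s δ : ℝ} {τ : Expo} {c : ℂ} {f : HahnSeries Expo ℂ} {b : ℝ≥0}
    (hK₀ : 0 ≤ K₀) (hr : 0 < r) (hrr : r ≤ r₀) (hδ : 0 < δ)
    (hK : K₀ + (K₀ * |reE τ| + |imE τ|) / δ ≤ K)
    (hf : wnorm (wt K₀ r₀ (s - reE τ)) f ≤ b) (h : ReGe δ (HahnSeries.single τ c * f)) :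
    Bd K r s (HahnSeries.single τ c * f)
      (‖c‖₊ * ((r / r₀) ^ δ * r₀ ^ reE τ).toNNReal * b) := by
  refine ⟨h.mono hδ.le, ?_⟩
  set B := ENNReal.ofReal ((r / r₀) ^ δ * r₀ ^ reE τ) with hB
  have h1 : wnorm (wt K r s) (HahnSeries.single τ c * f) ≤
      wnorm (fun _ => B) (HahnSeries.single τ c) * wnorm (wt K₀ r₀ (s - reE τ)) f := by
    refine wnorm_mul_le fun u v hu hv => ?_
    have huτ : u = τ := by
      by_contra hne
      exact hu (HahnSeries.coeff_single_of_ne hne)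
    subst huτ
    refine wt_shift_le hK₀ hr hrr hδ hK (h _ ?_)
    rw [add_comm, HahnSeries.coeff_single_mul_add]
    exact mul_ne_zero (by simpa using hu) hv
  refine h1.trans ?_
  rw [wnorm_single, ENNReal.coe_mul, ENNReal.coe_mul]
  exact mul_le_mul' le_rfl hf

/-! ### Series of uniformly small norm -/

/-- The truncated norms of `f` become uniformly small as the radius tends to `0`. -/
def Small (K : ℝ) (f : HahnSeries Expo ℂ) : Prop :=
  ∀ η : ℝ≥0, 0 < η → ∀ᶠ r in 𝓝[>] (0 : ℝ), ∀ s, Bd K r s f η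

theorem Small.zero (K : ℝ) : Small K 0 := fun _ _ =>
  Eventually.of_forall fun _ _ => Bd.zero.mono zero_le

theorem Small.add {K : ℝ} {f g : HahnSeries Expo ℂ} (hf : Small K f) (hg : Small K g) :
    Small K (f + g) := by
  intro η hη
  filter_upwards [hf (η / 2) (half_pos hη), hg (η / 2) (half_pos hη)] with r h1 h2 s
  exact ((h1 s).add (h2 s)).mono (add_halves η).le

theorem Small.sum {ι : Type*} {K : ℝ} (S : Finset ι) {f : ι → HahnSeries Expo ℂ}
    (h : ∀ i ∈ S, Small K (f i)) : Small K (∑ i ∈ S, f i) :=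
  Finset.sum_induction _ _ (fun _ _ => Small.add) (Small.zero K) h

theorem Small.single {K : ℝ} {τ : Expo} (hτ : 0 < reE τ) (hc : InCone K τ) (z : ℂ) :
    Small K (HahnSeries.single τ z) := by
  intro η hη
  have h1 : Tendsto (fun r : ℝ => ‖z‖₊ * (r ^ reE τ).toNNReal) (𝓝[>] 0) (𝓝 0) := by
    have h2 : Tendsto (fun r : ℝ => r ^ reE τ) (𝓝 0) (𝓝 0) := by
      simpa [Real.zero_rpow hτ.ne'] using
        (Real.continuousAt_rpow_const 0 (reE τ) (Or.inr hτ.le)).tendsto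
    have h3 := (tendsto_real_toNNReal h2).const_mul ‖z‖₊
    simp only [Real.toNNReal_zero, mul_zero] at h3
    exact h3.mono_left nhdsWithin_le_nhds
  filter_upwards [h1.eventually (eventually_le_nhds hη)] with r hr s
  exact (Bd.single z hτ.le hc).mono hr

theorem Small.mahlerOp {K : ℝ} {l : ℕ} (hl : 2 ≤ l) {f : HahnSeries Expo ℂ} (h : Small K f) :
    Small K (mahlerOp l hl f) := by
  intro η hη
  filter_upwards [h η hη, Ioc_mem_nhdsGT (one_pos : (0 : ℝ) < 1)] with r hr hr1 s
  exact (hr s).mahlerOp hl hr1.1 hr1.2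

theorem Small.reGe {K : ℝ} {f : HahnSeries Expo ℂ} (h : Small K f) : ReGe 0 f := by
  obtain ⟨r, hr⟩ := (h 1 one_pos).exists
  exact (hr 0).1

/-! ### Algebra of the Mahler operator and of monomials -/

theorem mahlerOp_add {l : ℕ} (hl : 2 ≤ l) (f g : HahnSeries Expo ℂ) :
    mahlerOp l hl (f + g) = mahlerOp l hl f + mahlerOp l hl g :=
  HahnSeries.embDomain_add _ _ _

theorem mahlerOp_mul {l : ℕ} (hl : 2 ≤ l) (f g : HahnSeries Expo ℂ) :
    mahlerOp l hl (f * g) = mahlerOp l hl f * mahlerOp l hl g :=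
  HahnSeries.embDomain_mul _ (fun x y => nsmul_add x y l) _ _

theorem mahlerOp_single {l : ℕ} (hl : 2 ≤ l) (τ : Expo) (c : ℂ) :
    mahlerOp l hl (HahnSeries.single τ c) = HahnSeries.single (l • τ) c :=
  HahnSeries.embDomain_single

theorem mahlerOp_iterate_add {l : ℕ} (hl : 2 ≤ l) (j : ℕ) (f g : HahnSeries Expo ℂ) :
    (mahlerOp l hl)^[j] (f + g) = (mahlerOp l hl)^[j] f + (mahlerOp l hl)^[j] g := by
  induction j with
  | zero => rfl
  | succ j ih => simp only [Function.iterate_succ_apply', ih, mahlerOp_add]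

theorem mahlerOp_iterate_single_mul {l : ℕ} (hl : 2 ≤ l) (j : ℕ) (τ : Expo) (c : ℂ)
    (f : HahnSeries Expo ℂ) :
    (mahlerOp l hl)^[j] (HahnSeries.single τ c * f) =
      HahnSeries.single (l ^ j • τ) c * (mahlerOp l hl)^[j] f := by
  induction j with
  | zero => simp
  | succ j ih =>
    simp only [Function.iterate_succ_apply', ih, mahlerOp_mul, mahlerOp_single, pow_succ',
      mul_smul]

theorem Bd.sub {K r s : ℝ} {f g : HahnSeries Expo ℂ} {b c : ℝ≥0} (hf : Bd K r s f b)
    (hg : Bd K r s g c) : Bd K r s (f - g) (b + c) := by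
  have h := hf.add (hg.smul (-1))
  have h1 : f + (-1 : ℂ) • g = f - g := by
    ext γ
    simp [sub_eq_add_neg]
  rw [h1] at h
  simpa using h

theorem expo_add (z w : ℂ) : expo (z + w) = expo z + expo w := rfl

theorem expo_zero : expo 0 = 0 := rfl

theorem single_expo_mul (z w a b : ℂ) :
    HahnSeries.single (expo z) a * HahnSeries.single (expo w) b =
      HahnSeries.single (expo (z + w)) (a * b) := by
  rw [HahnSeries.single_mul_single, expo_add]

theorem tendsto_shift_const (r₀ : ℝ) {δ : ℝ} (hδ : 0 < δ) (x : ℝ) (c b : ℝ≥0) :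
    Tendsto (fun r : ℝ => c * ((r / r₀) ^ δ * r₀ ^ x).toNNReal * b) (𝓝[>] 0) (𝓝 0) := by
  have h1 : Tendsto (fun r : ℝ => (r / r₀) ^ δ * r₀ ^ x) (𝓝 0) (𝓝 0) := by
    have h2 : Tendsto (fun r : ℝ => r / r₀) (𝓝 0) (𝓝 0) := by
      simpa using (continuous_id.div_const r₀).tendsto 0
    have h3 : Tendsto (fun r : ℝ => r ^ δ) (𝓝 0) (𝓝 0) := by
      simpa [Real.zero_rpow hδ.ne'] using
        (Real.continuousAt_rpow_const 0 δ (Or.inr hδ.le)).tendsto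
    simpa using (h3.comp h2).mul_const (r₀ ^ x)
  have h4 := ((tendsto_real_toNNReal h1).const_mul c).mul_const b
  simp only [Real.toNNReal_zero, mul_zero, zero_mul] at h4
  exact h4.mono_left nhdsWithin_le_nhds

/-! ### The majorant estimate -/

/-- The linear part of the substitution at a truncation of the solution: up to terms of higher
order it is the monomial `A₀ x^ν`. -/
theorem exists_reGe_linear_part {m : ℕ} (G : (Fin m → ℂ) → ℂ)
    {a Φ : Fin m → HahnSeries Expo ℂ} {A₀ ν : ℂ} {M ε : ℝ} (hM : ν.re + 1 ≤ M) (hε : 0 < ε)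
    (hΦ : ∀ i, ReGe ε (Φ i)) (ha : ∀ i, ReGe 0 (a i)) (hΦa : ∀ i, ReGe M (a i - Φ i))
    (hder : HasForm (substCoeff G Φ) A₀ ν) :
    ∃ δ, 0 < δ ∧ δ ≤ 1 ∧ ∃ D₀ : ℕ, ∀ D, D₀ ≤ D →
      ReGe (ν.re + δ) (taylorSum G D a - HahnSeries.single (expo ν) A₀) := by
  -- Terms of degree at least `D₀` have real part above `Re ν + 1`, so one fixed polynomial decides
  -- `δ` for every `D ≥ D₀`.
  obtain ⟨D₀, hD₀⟩ := exists_nat_gt ((ν.re + 1) / ε)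
  have hD₀' : ν.re + 1 < D₀ * ε := (div_lt_iff₀ hε).1 hD₀
  obtain ⟨δ₀, hδ₀, hH⟩ := exists_reGe_of_lt (c := ν.re)
    (f := taylorSum G D₀ Φ - HahnSeries.single (expo ν) A₀) (by
      intro γ hγ
      by_contra hle
      apply hγ
      rw [← expo_mk γ] at hle ⊢
      set κ : ℂ := ⟨reE γ, imE γ⟩
      have hle' : κ.re ≤ ν.re := not_lt.1 hle
      rw [HahnSeries.coeff_sub, coeff_taylorSum G hε hΦ (by linarith)]
      by_cases hκ : κ = ν
      · rw [hκ, hder.1]; simp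
      · rw [hder.2 κ hκ hle', HahnSeries.coeff_single_of_ne (expo_injective.ne hκ), sub_zero])
  refine ⟨min δ₀ 1, lt_min hδ₀ one_pos, min_le_right _ _, D₀, fun D hD => ?_⟩
  have h1 : ReGe (ν.re + min δ₀ 1) (taylorSum G D a - taylorSum G D Φ) :=
    (ReGe.taylorSum_congr G ha (fun i => (hΦ i).mono hε.le) hΦa D).mono
      (by linarith [min_le_right δ₀ 1])
  have h2 : ReGe (ν.re + min δ₀ 1) (taylorSum G D Φ - taylorSum G D₀ Φ) :=
    (ReGe.taylorSum_sub G hε hΦ hD).mono (by linarith [min_le_right δ₀ 1])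
  have h3 := (h1.add h2).add (hH.mono (b := ν.re + min δ₀ 1) (by linarith [min_le_left δ₀ 1]))
  convert h3 using 1
  ring

theorem ReGe.taylorSum_of_solution {m : ℕ} {G : (Fin m → ℂ) → ℂ} {Φ : Fin m → HahnSeries Expo ℂ}
    {ε : ℝ} (hε : 0 < ε) (hΦ : ∀ i, ReGe ε (Φ i)) (h : ∀ κ, substCoeff G Φ κ = 0) (D : ℕ) :
    ReGe (D * ε) (taylorSum G D Φ) := by
  intro γ hγ
  by_contra hlt
  apply hγ
  rw [← expo_mk γ, coeff_taylorSum G hε hΦ (not_le.1 hlt), h]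

/-- The subtraction only deletes the coefficient at `τ`. This bounds `H` by the norm of the whole
derivative. -/
theorem wnorm_sub_single_le {W : Expo → ℝ≥0∞} {f : HahnSeries Expo ℂ} {τ : Expo} {c : ℂ}
    (h : (f - HahnSeries.single τ c).coeff τ = 0) :
    wnorm W (f - HahnSeries.single τ c) ≤ wnorm W f := by
  refine ENNReal.tsum_le_tsum fun γ => ?_
  by_cases hγ : γ = τ
  · rw [hγ, h]; simp
  · rw [HahnSeries.coeff_sub, HahnSeries.coeff_single_of_ne hγ, sub_zero]

/-- The majorant estimate: the tail `χ` of a formal solution has uniformly bounded truncated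
norms for some cone and some radius. -/
theorem exists_bd_of_solution {n : ℕ} {F : (Fin (n + 2) → ℂ) → ℂ} (hF : AnalyticAt ℂ F 0)
    {A₀ ν : ℂ} (hA₀ : A₀ ≠ 0) {a c Φ : Fin (n + 2) → HahnSeries Expo ℂ}
    {χ : HahnSeries Expo ℂ} {M ε K₀ : ℝ} (hM : ν.re + 1 ≤ M) (hM0 : 0 ≤ M) (hε : 0 < ε)
    (hΦ : ∀ i, ReGe ε (Φ i))
    (hΦeq : Φ = fun i => a i + HahnSeries.single (expo M) 1 *
      (Pi.single 1 χ : Fin (n + 2) → HahnSeries Expo ℂ) i +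
        HahnSeries.single (expo M) 1 ^ 2 * c i)
    (hχ : ReGe 1 χ) (hsol : ∀ κ, substCoeff F Φ κ = 0)
    (hder : HasForm (substCoeff (partialY0 F) Φ) A₀ ν) (hK₀ : 0 ≤ K₀)
    (ha : ∀ i, Small K₀ (a i)) (hc0 : ∀ i, ReGe 0 (c i))
    (hc : ∀ (K r s : ℝ) (b : ℝ≥0), 0 ≤ K → 0 < r → r ≤ 1 → Bd K r s χ b →
      ∀ i, Bd K r s (c i) b) :
    ∃ (K r : ℝ) (b : ℝ≥0), K₀ ≤ K ∧ 0 < r ∧ r ≤ 1 ∧ ∀ s, Bd K r s χ b := by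
  set t : HahnSeries Expo ℂ := HahnSeries.single (expo M) 1 with ht
  have htM : ReGe M t := ReGe.single (expo M) 1
  have hχ0 : ReGe 0 χ := hχ.mono zero_le_one
  have hb0 : ∀ i, ReGe 0 ((Pi.single 1 χ : Fin (n + 2) → HahnSeries Expo ℂ) i) := by
    intro i
    by_cases h : i = 1
    · subst h; simpa using hχ0
    · rw [Pi.single_eq_of_ne h]; exact ReGe.zero 0
  have hΦa : ∀ i, ReGe M (a i - Φ i) := by
    intro i
    have h1 := ((htM.mul (hb0 i)).add (((htM.mul htM).mul (hc0 i)).mono (by linarith))).neg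
    rw [add_zero] at h1
    rw [hΦeq]
    convert h1 using 1
    ring
  obtain ⟨C, A, hC, hA, hCA⟩ := exists_taylorCoeff_le hF
  obtain ⟨C', A', hC', hA', hCA'⟩ := exists_taylorCoeff_le (analyticAt_partialY0 hF)
  obtain ⟨δ, hδ, hδ1, D₀, hH⟩ := exists_reGe_linear_part (partialY0 F) hM hε hΦ
    (fun i => (ha i).reGe) hΦa hder
  -- The three copies of `η` majorize `a`, `χ` and `c`; the Taylor sums then have ratio at most
  -- `1/2`.
  obtain ⟨η, hη, hAη, hA'η⟩ : ∃ η : ℝ≥0, 0 < η ∧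
      A * ∑ _i : Fin (n + 2), (η + η + η) ≤ 2⁻¹ ∧ A' * ∑ _i : Fin (n + 2), η ≤ 2⁻¹ := by
    have h1 : Tendsto (fun η : ℝ≥0 => A * ∑ _i : Fin (n + 2), (η + η + η)) (𝓝[>] 0) (𝓝 0) := by
      have : Continuous (fun η : ℝ≥0 => A * ∑ _i : Fin (n + 2), (η + η + η)) := by fun_prop
      simpa using (this.tendsto 0).mono_left nhdsWithin_le_nhds
    have h2 : Tendsto (fun η : ℝ≥0 => A' * ∑ _i : Fin (n + 2), η) (𝓝[>] 0) (𝓝 0) := by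
      have : Continuous (fun η : ℝ≥0 => A' * ∑ _i : Fin (n + 2), η) := by fun_prop
      simpa using (this.tendsto 0).mono_left nhdsWithin_le_nhds
    have hpos : (0 : ℝ≥0) < 2⁻¹ := by norm_num
    obtain ⟨η, h3, h4, h5⟩ := ((h1.eventually (eventually_le_nhds hpos)).and
      ((h2.eventually (eventually_le_nhds hpos)).and self_mem_nhdsWithin)).exists
    exact ⟨η, h5, h3, h4⟩
  have hAη' : A * ∑ _i : Fin (n + 2), η ≤ 2⁻¹ := by
    refine le_trans (mul_le_mul' le_rfl (Finset.sum_le_sum fun _ _ => ?_)) hAη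
    rw [add_assoc]; exact le_self_add
  obtain ⟨r₀, har₀, hr₀⟩ := ((eventually_all.2 fun i => ha i η hη).and
    (Ioc_mem_nhdsGT (one_pos : (0 : ℝ) < 1))).exists
  -- The cone must absorb the shifts by `-ν` and `-ν - M` and contain `M - ν`, whose real part is at
  -- least `1`. It is fixed before `r`.
  obtain ⟨K, hK1, hK2, hK3⟩ : ∃ K : ℝ,
      K₀ + (K₀ * |reE (expo (-ν))| + |imE (expo (-ν))|) / δ ≤ K ∧
      K₀ + (K₀ * |reE (expo (-ν - M))| + |imE (expo (-ν - M))|) / δ ≤ K ∧ |ν.im| ≤ K :=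
    ⟨max _ (max _ _), le_max_left _ _, (le_max_left _ _).trans (le_max_right _ _),
      (le_max_right _ _).trans (le_max_right _ _)⟩
  have hK₀K : K₀ ≤ K := le_trans (le_add_of_nonneg_right (by positivity)) hK1
  have hK : 0 ≤ K := hK₀.trans hK₀K
  have hIoc : ∀ᶠ r in 𝓝[>] (0 : ℝ), r ∈ Set.Ioc 0 r₀ := Ioc_mem_nhdsGT hr₀.1
  obtain ⟨r, ⟨hr, hrr⟩, he1, he2, he3⟩ := (hIoc.and
    (((tendsto_shift_const r₀ hδ (reE (expo (-ν))) ‖A₀⁻¹‖₊ (C' * 2)).eventually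
      (eventually_le_nhds (by norm_num : (0 : ℝ≥0) < 3⁻¹))).and
    (((tendsto_shift_const r₀ hδ (reE (expo (-ν - M))) ‖A₀⁻¹‖₊ (C * 2)).eventually
      (eventually_le_nhds (show (0 : ℝ≥0) < 3⁻¹ * η by positivity))).and
    ((tendsto_shift_const 1 (show 0 < M - ν.re by linarith) 0 ‖A₀⁻¹‖₊ (C * 2)).eventually
      (eventually_le_nhds (show (0 : ℝ≥0) < 3⁻¹ * η by positivity)))))).exists
  have hr1 : r ≤ 1 := hrr.trans hr₀.2
  refine ⟨K, r, η, hK₀K, hr, hr1, ?_⟩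
  have step : ∀ s, Bd K r s χ η → Bd K r (s + δ) χ η := by
    intro s hs
    have htB : Bd K r s t 1 := by
      refine (Bd.single (K := K) (r := r) (s := s) (τ := expo M) 1 hM0 ?_).mono ?_
      · change |(M : ℂ).im| ≤ K * (M : ℂ).re
        simpa using mul_nonneg hK hM0
      · simpa [reE, expo] using Real.rpow_le_one hr.le hr1 hM0
    have haB : ∀ i, Bd K r s (a i) η := fun i => (har₀ i s).mono_weight hK₀K hr hrr
    have hbB : ∀ i, Bd K r s ((Pi.single 1 χ : Fin (n + 2) → HahnSeries Expo ℂ) i) η := by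
      intro i
      by_cases h : i = 1
      · subst h; simpa using hs
      · rw [Pi.single_eq_of_ne h]; exact Bd.zero.mono zero_le
    -- The degree depends on `s`: after division by `A₀ x^{ν + M}` the truncation error of `F(Φ) =
    -- 0` must lie beyond `s + δ`. No bound above depends on `D`.
    obtain ⟨D, hD⟩ := exists_nat_gt (max (D₀ : ℝ) ((max s 0 + 1 + M + ν.re) / ε))
    have hDD₀ : D₀ ≤ D := by exact_mod_cast ((le_max_left _ _).trans_lt hD).le
    have hDε : max s 0 + 1 + M + ν.re < D * ε :=
      (div_lt_iff₀ hε).1 ((le_max_right _ _).trans_lt hD)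
    obtain ⟨R, hR, hRB⟩ := taylorSum_expand hF hCA hr htB haB hbB (hc K r s η hK hr hr1 hs) hAη D
    rw [← hΦeq] at hR
    set H := taylorSum (partialY0 F) D a - HahnSeries.single (expo ν) A₀ with hHdef
    have hHR : ReGe (ν.re + δ) H := hH D hDD₀
    set u : HahnSeries Expo ℂ := HahnSeries.single (expo (-ν - M)) A₀⁻¹ with hu
    have hut : u * t = HahnSeries.single (expo (-ν)) A₀⁻¹ := by
      rw [hu, ht, single_expo_mul, sub_add_cancel, mul_one]
    have hutν : u * t * HahnSeries.single (expo ν) A₀ = 1 := by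
      rw [hut, single_expo_mul, neg_add_cancel, inv_mul_cancel₀ hA₀]
      rfl
    have hutt : u * t ^ 2 = HahnSeries.single (expo (M - ν)) A₀⁻¹ := by
      rw [pow_two, ← mul_assoc, hut, ht, single_expo_mul, mul_one, neg_add_eq_sub]
    set E := taylorSum F (D + 1) Φ with hE
    set S := taylorSum F (D + 1) a with hS
    -- The fixed-point equation: the second-order expansion divided by `A₀ x^ν t`.
    have hχeq : χ = u * E - u * S - u * t * H * χ - u * t ^ 2 * R := by
      have h1 : taylorSum (partialY0 F) D a = H + HahnSeries.single (expo ν) A₀ := by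
        rw [hHdef]; ring
      rw [h1] at hR
      rw [hR]
      linear_combination (-χ) * hutν
    have huE : ReGe (max s 0 + 1) (u * E) := by
      have h1 := (ReGe.single (expo (-ν - M)) A₀⁻¹).mul
        (ReGe.taylorSum_of_solution hε hΦ hsol (D + 1))
      refine h1.mono ?_
      have h2 : reE (expo (-ν - M)) = -ν.re - M := by simp [reE, expo]
      rw [h2]
      push_cast
      linarith
    have hg1 : ReGe δ (u * t * H) := by
      rw [hut]
      refine ((ReGe.single (expo (-ν)) A₀⁻¹).mul hHR).mono ?_
      have h2 : reE (expo (-ν)) = -ν.re := by simp [reE, expo]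
      rw [h2]; linarith
    have hreMν : reE (expo (M - ν)) = M - ν.re := by simp [reE, expo]
    have hutt1 : ReGe δ (u * t ^ 2) := by
      rw [hutt]
      refine (ReGe.single (expo (M - ν)) A₀⁻¹).mono ?_
      rw [hreMν]; linarith
    -- Nothing direct bounds the order of `F(a) / (A₀ x^ν t)`. The equation itself does, since all
    -- its other terms have order at least `δ`.
    have hg0 : ReGe δ (u * S) := by
      have h1 : u * S = u * E - χ - u * t * H * χ - u * t ^ 2 * R := by
        linear_combination hχeq
      rw [h1]
      exact (((huE.mono (by linarith [le_max_right s 0])).sub (hχ.mono hδ1)).sub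
        ((hg1.mul hχ0).mono (by linarith))).sub ((hutt1.mul hRB.1).mono (by linarith))
    have hB0 : Bd K r (s + δ) (u * E) 0 :=
      ⟨huE.mono (by linarith [le_max_right s 0]), by
        rw [wnorm_wt_eq_zero (huE.mono (by linarith [le_max_left s 0]))]
        exact zero_le⟩
    have hB1 : Bd K r (s + δ) (u * S) (3⁻¹ * η) :=
      (Bd.shift hK₀ hr hrr hδ hK2
        (taylorSum_bd hCA hr₀.1 (fun i => har₀ i _) hAη' (D + 1)).2 hg0).mono he2
    have hB2 : Bd K r (s + δ) (u * t * H) 3⁻¹ := by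
      have h1 := hg1
      rw [hut] at h1 ⊢
      refine (Bd.shift hK₀ hr hrr hδ hK1 (le_trans (wnorm_sub_single_le ?_)
        (taylorSum_bd hCA' hr₀.1 (fun i => har₀ i _) hA'η D).2) h1).mono he1
      by_contra hne
      have h2 : ν.re + δ ≤ ν.re := hHR _ hne
      linarith
    have hB3 : Bd K r (s + δ) (u * t ^ 2 * R) (3⁻¹ * η) := by
      have h1 : Bd K r (s + δ) (u * t ^ 2)
          (‖A₀⁻¹‖₊ * (r ^ reE (expo (M - ν))).toNNReal) := by
        rw [hutt]
        refine Bd.single _ (by rw [hreMν]; linarith) ?_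
        have h2 : imE (expo (M - ν)) = -ν.im := by simp [imE, expo]
        rw [InCone, hreMν, h2, abs_neg]
        nlinarith
      refine (Bd.mul_gain hr hδ.le h1 hutt1 hRB).mono (le_trans (le_of_eq ?_) he3)
      rw [hreMν]
      simp
    rw [hχeq]
    refine (((hB0.sub hB1).sub (hB2.mul_gain hr hδ.le hg1 hs)).sub hB3).mono (le_of_eq ?_)
    rw [← NNReal.coe_inj]
    push_cast
    ring
  have hind : ∀ k : ℕ, ∀ s ≤ k * δ, Bd K r s χ η := by
    intro k
    induction k with
    | zero =>
      intro s hs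
      refine ⟨hχ0, ?_⟩
      -- For `s ≤ 0` every exponent of `χ` is truncated away, so the induction starts from norm
      -- zero.
      rw [wnorm_wt_eq_zero (hχ.mono (by simp at hs; linarith))]
      exact zero_le
    | succ k ih =>
      intro s hs
      have := step (s - δ) (ih (s - δ) (by push_cast at hs; linarith))
      rwa [sub_add_cancel] at this
  intro s
  obtain ⟨k, hk⟩ := exists_nat_gt (s / δ)
  exact hind k s ((div_lt_iff₀ hδ).1 hk).le

/-! ### Splitting the solution into a partial sum and a tail -/

/-- The sum of the first `N` terms of a generalized power series. -/
def GenPowerSeries.partialSum (φ : GenPowerSeries) (N : ℕ) : HahnSeries Expo ℂ :=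
  ∑ k ∈ Finset.range N, HahnSeries.single (expo (φ.exponent k)) (φ.coeff k)

theorem GenPowerSeries.exists_of_toHahn_coeff_ne_zero (φ : GenPowerSeries) {γ : Expo}
    (h : φ.toHahn.coeff γ ≠ 0) : ∃ k, expo (φ.exponent k) = γ := by
  by_contra hne
  push Not at hne
  exact h (by simp [GenPowerSeries.toHahn, hne])

theorem GenPowerSeries.tail_coeff (φ : GenPowerSeries) {N k : ℕ} (h : N ≤ k) :
    (φ.toHahn - φ.partialSum N).coeff (expo (φ.exponent k)) = φ.coeff k := by
  rw [HahnSeries.coeff_sub, φ.toHahn_coeff, partialSum, HahnSeries.coeff_sum,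
    Finset.sum_eq_zero, sub_zero]
  intro j hj
  refine HahnSeries.coeff_single_of_ne (expo_injective.ne (φ.exponent_injective.ne ?_))
  have := Finset.mem_range.1 hj
  omega

theorem GenPowerSeries.tail_reGe (φ : GenPowerSeries) {N : ℕ} {M : ℝ}
    (h : ∀ k, N ≤ k → M ≤ (φ.exponent k).re) : ReGe M (φ.toHahn - φ.partialSum N) := by
  intro γ hγ
  by_cases hex : ∃ k, expo (φ.exponent k) = γ
  · obtain ⟨k, rfl⟩ := hex
    by_cases hk : N ≤ k
    · exact h k hk
    · refine absurd ?_ hγ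
      rw [HahnSeries.coeff_sub, φ.toHahn_coeff, partialSum, HahnSeries.coeff_sum,
        Finset.sum_eq_single k]
      · simp
      · intro j _ hj
        exact HahnSeries.coeff_single_of_ne
          (expo_injective.ne (φ.exponent_injective.ne hj.symm))
      · intro hk'
        exact absurd (Finset.mem_range.2 (not_le.1 hk)) hk'
  · push Not at hex
    refine absurd ?_ hγ
    rw [HahnSeries.coeff_sub, partialSum, HahnSeries.coeff_sum, Finset.sum_eq_zero, sub_zero]
    · by_contra hne
      obtain ⟨k, hk⟩ := φ.exists_of_toHahn_coeff_ne_zero hne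
      exact hex k hk
    · intro k _
      exact HahnSeries.coeff_single_of_ne (hex k).symm

theorem GenPowerSeries.exists_inCone (φ : GenPowerSeries) (N : ℕ) :
    ∃ K : ℝ, 0 ≤ K ∧ ∀ k < N, InCone K (expo (φ.exponent k)) := by
  have hterm : ∀ k, 0 ≤ |(φ.exponent k).im| / (φ.exponent k).re :=
    fun k => div_nonneg (abs_nonneg _) (φ.re_pos k).le
  refine ⟨∑ k ∈ Finset.range N, |(φ.exponent k).im| / (φ.exponent k).re,
    Finset.sum_nonneg fun k _ => hterm k, fun k hk => ?_⟩
  change |(φ.exponent k).im| ≤ _ * (φ.exponent k).re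
  rw [← div_le_iff₀ (φ.re_pos k)]
  exact Finset.single_le_sum (f := fun k => |(φ.exponent k).im| / (φ.exponent k).re)
    (fun k _ => hterm k) (Finset.mem_range.2 hk)

theorem Small.mahlerOp_iterate {K : ℝ} {l : ℕ} (hl : 2 ≤ l) {f : HahnSeries Expo ℂ}
    (h : Small K f) (j : ℕ) : Small K ((GenSeries.mahlerOp l hl)^[j] f) := by
  induction j with
  | zero => exact h
  | succ j ih => rw [Function.iterate_succ_apply']; exact ih.mahlerOp hl

theorem Bd.mahlerOp_iterate {K r s : ℝ} {b : ℝ≥0} {l : ℕ} (hl : 2 ≤ l) (hr : 0 < r)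
    (hr1 : r ≤ 1) {f : HahnSeries Expo ℂ} (h : Bd K r s f b) (j : ℕ) :
    Bd K r s ((GenSeries.mahlerOp l hl)^[j] f) b := by
  induction j with
  | zero => exact h
  | succ j ih => rw [Function.iterate_succ_apply']; exact ih.mahlerOp hl hr hr1

/-- The part of `(x, φ, μφ, …, μ^n φ)` divisible by `x^{2M}`, divided by `x^{2M}`, when the tail
of `φ` is `x^M χ`. -/
def higherTuple (n ℓ : ℕ) (hℓ : 2 ≤ ℓ) (M : ℝ) (χ : HahnSeries Expo ℂ) :
    Fin (n + 2) → HahnSeries Expo ℂ :=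
  Fin.cons 0 (Fin.cons 0 fun j : Fin n =>
    HahnSeries.single (expo (((ℓ : ℝ) ^ ((j : ℕ) + 1) - 2) * M : ℝ)) 1 *
      (mahlerOp ℓ hℓ)^[(j : ℕ) + 1] χ)

theorem nsmul_expo_ofReal (l : ℕ) (M : ℝ) : l • expo (M : ℂ) = expo ((l * M : ℝ) : ℂ) := by
  induction l with
  | zero => simp [expo_zero]
  | succ l ih =>
    rw [succ_nsmul, ih, ← expo_add]
    congr 1
    push_cast
    ring

theorem mahlerTuple_eq (n ℓ : ℕ) (hℓ : 2 ≤ ℓ) (φ : GenPowerSeries) (M : ℝ)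
    {P χ : HahnSeries Expo ℂ} (h : φ.toHahn = P + HahnSeries.single (expo M) 1 * χ) :
    mahlerTuple n ℓ hℓ φ = fun i =>
      (Fin.cons monomialX fun j : Fin (n + 1) => (mahlerOp ℓ hℓ)^[(j : ℕ)] P :
        Fin (n + 2) → HahnSeries Expo ℂ) i +
      HahnSeries.single (expo M) 1 * (Pi.single 1 χ : Fin (n + 2) → HahnSeries Expo ℂ) i +
      HahnSeries.single (expo M) 1 ^ 2 * higherTuple n ℓ hℓ M χ i := by
  funext i
  refine Fin.cases ?_ (fun i => Fin.cases ?_ (fun j => ?_) i) i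
  · simp [mahlerTuple, higherTuple]
  · rw [show (Fin.succ 0 : Fin (n + 2)) = 1 from rfl, Pi.single_eq_same]
    rw [show (1 : Fin (n + 2)) = Fin.succ 0 from rfl]
    simp [mahlerTuple, higherTuple, h]
  -- For `μ^{j+1}` the monomial `x^M` becomes `x^{ℓ^{j+1} M}`; the surplus over `x^{2M}` is the
  -- monomial in `higherTuple`.
  · rw [Pi.single_eq_of_ne (by simp [Fin.ext_iff])]
    simp only [mahlerTuple, higherTuple, Fin.cons_succ, Fin.val_succ]
    rw [h, mahlerOp_iterate_add, mahlerOp_iterate_single_mul, nsmul_expo_ofReal, mul_zero,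
      add_zero, ← mul_assoc, pow_two, single_expo_mul, single_expo_mul]
    congr 4
    · refine congrArg expo ?_
      push_cast
      ring
    · simp

theorem higherTuple_bd (n ℓ : ℕ) (hℓ : 2 ≤ ℓ) {M : ℝ} (hM : 0 ≤ M) {χ : HahnSeries Expo ℂ}
    {K r s : ℝ} {b : ℝ≥0} (hK : 0 ≤ K) (hr : 0 < r) (hr1 : r ≤ 1) (hχ : Bd K r s χ b)
    (i : Fin (n + 2)) : Bd K r s (higherTuple n ℓ hℓ M χ i) b := by
  refine Fin.cases ?_ (fun i => Fin.cases ?_ (fun j => ?_) i) i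
  · exact Bd.zero.mono zero_le
  · exact Bd.zero.mono zero_le
  · simp only [higherTuple, Fin.cons_succ]
    have h2 : (2 : ℝ) ≤ (ℓ : ℝ) ^ ((j : ℕ) + 1) := by
      have h3 : (2 : ℝ) ≤ ℓ := by exact_mod_cast hℓ
      exact h3.trans (le_self_pow₀ (by linarith) (Nat.succ_ne_zero _))
    set x : ℝ := ((ℓ : ℝ) ^ ((j : ℕ) + 1) - 2) * M
    have hx : 0 ≤ x := mul_nonneg (by linarith) hM
    have h4 : Bd K r s (HahnSeries.single (expo (x : ℂ)) 1) 1 := by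
      refine (Bd.single (K := K) (r := r) (s := s) (τ := expo x) 1 hx ?_).mono ?_
      · change |(x : ℂ).im| ≤ K * (x : ℂ).re
        simpa using mul_nonneg hK hx
      · simpa [reE, expo] using Real.rpow_le_one hr.le hr1 hx
    exact (h4.mul hr (hχ.mahlerOp_iterate hℓ hr hr1 _)).mono (one_mul b).le

/-! ### From uniform norm bounds to absolute convergence -/

/-- Truncating just above `Re γ` makes the weight of `γ` visible; off the cone it is infinite,
against a finite norm. -/
theorem Bd.inCone {K r : ℝ} {f : HahnSeries Expo ℂ} {b : ℝ≥0} (h : ∀ s, Bd K r s f b) {γ : Expo}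
    (hγ : f.coeff γ ≠ 0) : InCone K γ := by
  by_contra hc
  have h1 : ‖f.coeff γ‖ₑ * wt K r (reE γ + 1) γ ≤ b :=
    (ENNReal.le_tsum γ).trans (h (reE γ + 1)).2
  rw [wt_top (by linarith) hc, ENNReal.mul_top (by simpa using hγ)] at h1
  exact absurd h1 (by simp)

theorem Bd.sum_le {K r : ℝ} {f : HahnSeries Expo ℂ} {b : ℝ≥0} (h : ∀ s, Bd K r s f b)
    (hr : 0 < r) (S : Finset Expo) : ∑ γ ∈ S, ‖f.coeff γ‖ * r ^ reE γ ≤ b := by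
  obtain ⟨s, hs⟩ := (S.image reE).exists_le
  have h1 : ∑ γ ∈ S, ‖f.coeff γ‖ₑ * wt K r (s + 1) γ ≤ b :=
    (ENNReal.sum_le_tsum S).trans (h (s + 1)).2
  have h2 : ENNReal.ofReal (∑ γ ∈ S, ‖f.coeff γ‖ * r ^ reE γ) ≤ ENNReal.ofReal b := by
    rw [ENNReal.ofReal_coe_nnreal]
    refine le_trans (le_of_eq ?_) h1
    rw [ENNReal.ofReal_sum_of_nonneg fun γ _ => by positivity]
    refine Finset.sum_congr rfl fun γ hγ => ?_
    by_cases h0 : f.coeff γ = 0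
    · simp [h0]
    · rw [wt_of_lt (by linarith [hs _ (Finset.mem_image_of_mem _ hγ)]) (Bd.inCone h h0),
        ENNReal.ofReal_mul (norm_nonneg _), ofReal_norm]
  exact (ENNReal.ofReal_le_ofReal_iff b.2).1 h2

/-- A formal solution converges absolutely for some positive value of `x`, and its exponents lie
in a cone. -/
theorem exists_summable_of_solution (n ℓ : ℕ) (hℓ : 2 ≤ ℓ) {F : (Fin (n + 2) → ℂ) → ℂ}
    (hF : AnalyticAt ℂ F 0) (φ : GenPowerSeries) (hφ : IsFormalMahlerSolution n ℓ hℓ F φ)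
    {A₀ ν : ℂ} (hA₀ : A₀ ≠ 0)
    (hder : HasForm (substCoeff (partialY0 F) (mahlerTuple n ℓ hℓ φ)) A₀ ν) :
    ∃ K r : ℝ, 0 < r ∧ (Summable fun k => ‖φ.coeff k‖ * r ^ (φ.exponent k).re) ∧
      ∀ k, φ.coeff k ≠ 0 → |(φ.exponent k).im| ≤ K * (φ.exponent k).re := by
  obtain ⟨ε, hε, hΦ⟩ := mahlerTuple_re_ge n ℓ hℓ φ
  -- `M ≥ Re ν + 1` leaves positive order after dividing `x^M` by `x^ν`; `M ≥ 0` gives `x^M` norm at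
  -- most `1` for `r ≤ 1`.
  set M : ℝ := max (ν.re + 1) 0
  have hM0 : 0 ≤ M := le_max_right _ _
  obtain ⟨N, hN⟩ := eventually_atTop.1 (φ.re_tendsto.eventually (eventually_ge_atTop (M + 1)))
  obtain ⟨K₀, hK₀, hcone⟩ := φ.exists_inCone N
  set P := φ.partialSum N with hP
  set χ : HahnSeries Expo ℂ := HahnSeries.single (expo (-M : ℂ)) 1 * (φ.toHahn - P) with hχ
  have hχ1 : ReGe 1 χ := by
    refine ((ReGe.single (expo (-M : ℂ)) 1).mul (φ.tail_reGe hN)).mono ?_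
    have : reE (expo (-M : ℂ)) = -M := by simp [reE, expo]
    rw [this]; linarith
  have hdecomp : φ.toHahn = P + HahnSeries.single (expo (M : ℂ)) 1 * χ := by
    rw [hχ, ← mul_assoc, single_expo_mul, add_neg_cancel, mul_one, expo_zero,
      show HahnSeries.single (0 : Expo) (1 : ℂ) = 1 from rfl]
    ring
  have hPs : Small K₀ P :=
    Small.sum _ fun k hk => Small.single (τ := expo (φ.exponent k)) (φ.re_pos k) (hcone k (Finset.mem_range.1 hk)) _
  have ha : ∀ i, Small K₀ ((Fin.cons monomialX fun j : Fin (n + 1) => (mahlerOp ℓ hℓ)^[(j : ℕ)] P :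
      Fin (n + 2) → HahnSeries Expo ℂ) i) := by
    refine Fin.cases ?_ fun j => ?_
    · refine Small.single (τ := expo 1) (by simp [reE, expo]) ?_ 1
      simpa [InCone, imE, reE, expo] using hK₀
    · exact hPs.mahlerOp_iterate hℓ j
  have hbd := fun (K r s : ℝ) (b : ℝ≥0) (hK : 0 ≤ K) (hr : 0 < r) (hr1 : r ≤ 1)
    (h : Bd K r s χ b) => higherTuple_bd n ℓ hℓ hM0 hK hr hr1 h
  have hc0 : ∀ i, ReGe 0 (higherTuple n ℓ hℓ M χ i) := fun i =>
    (hbd 0 1 0 0 le_rfl one_pos le_rfl ⟨hχ1.mono zero_le_one, by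
      rw [wnorm_wt_eq_zero (hχ1.mono zero_le_one)]; exact zero_le⟩ i).1
  obtain ⟨K, r, b, hKK, hr, hr1, hB⟩ := exists_bd_of_solution hF hA₀ (le_max_left _ _) hM0 hε hΦ
    (mahlerTuple_eq n ℓ hℓ φ M hdecomp) hχ1 hφ hder hK₀ ha hc0 hbd
  have hcoeff : ∀ k, N ≤ k → χ.coeff (expo (φ.exponent k - M)) = φ.coeff k := by
    intro k hk
    have h1 : expo (φ.exponent k - M) = expo (φ.exponent k) + expo (-M) := by
      rw [← expo_add, sub_eq_add_neg]
    rw [hχ, h1, HahnSeries.coeff_single_mul_add, one_mul, φ.tail_coeff hk]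
  refine ⟨K, r, hr, ?_, fun k hk => ?_⟩
  · rw [← summable_nat_add_iff N]
    have hinj : Function.Injective fun k => expo (φ.exponent (k + N) - M) := by
      intro i j hij
      have := φ.exponent_injective (sub_left_injective (expo_injective hij))
      omega
    have h1 : Summable fun k =>
        ‖χ.coeff (expo (φ.exponent (k + N) - M))‖ * r ^ reE (expo (φ.exponent (k + N) - M)) := by
      refine summable_of_sum_le (c := b) (fun k => by positivity) fun S => ?_
      have := Bd.sum_le hB hr (S.map ⟨_, hinj⟩)
      rwa [Finset.sum_map] at this
    refine (h1.mul_left (r ^ M)).congr fun k => ?_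
    have h2 : reE (expo (φ.exponent (k + N) - M)) = (φ.exponent (k + N)).re - M := by
      simp [reE, expo]
    rw [hcoeff _ (Nat.le_add_left _ _), h2, Real.rpow_sub hr]
    field_simp
  · by_cases hkN : k < N
    · exact InCone.mono (γ := expo (φ.exponent k)) hKK (φ.re_pos k).le (hcone k hkN)
    · have h1 : InCone K (expo (φ.exponent k - M)) :=
        Bd.inCone hB (by rwa [hcoeff k (not_lt.1 hkN)])
      have h2 : |(φ.exponent k).im| ≤ K * ((φ.exponent k).re - M) := by
        simpa [InCone, imE, reE, expo] using h1
      -- Adding the nonnegative real number `M` to an exponent keeps it in the cone.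
      nlinarith [mul_nonneg (hK₀.trans hKK) hM0]

/-! ### Branches of the logarithm and uniform convergence -/

/-- The imaginary part of a continuous branch of the logarithm on a sector is bounded. -/
theorem exists_abs_im_log_le {α β : ℝ} {logS : ℂ → ℂ} (hcont : ContinuousOn logS (sector α β))
    (hlog : ∀ x ∈ sector α β, Complex.exp (logS x) = x) :
    ∃ T, ∀ x ∈ sector α β, |(logS x).im| ≤ T := by
  set S : Set (ℝ × ℝ) := Set.univ ×ˢ Set.Ioo α β
  set e : ℝ × ℝ → ℂ := fun p => p.1 + p.2 * Complex.I
  have he : Continuous e := by fun_prop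
  have hmaps : Set.MapsTo (fun p => Complex.exp (e p)) S (sector α β) := by
    rintro ⟨u, θ⟩ ⟨-, hθ⟩
    refine ⟨Real.exp u, θ, Real.exp_pos u, hθ.1, hθ.2, ?_⟩
    simp [e, Complex.exp_add]
  have hconn : IsPreconnected S := isPreconnected_univ.prod isPreconnected_Ioo
  -- In the coordinates `u + iθ` the sector becomes a connected strip. There `g` is continuous and
  -- integer-valued, hence constant.
  set g : ℝ × ℝ → ℝ := fun p => ((logS (Complex.exp (e p))).im - p.2) / (2 * Real.pi)
  have hg : ContinuousOn g S := by
    have h1 : ContinuousOn (fun p => logS (Complex.exp (e p))) S :=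
      hcont.comp (Complex.continuous_exp.comp he).continuousOn hmaps
    exact ((Complex.continuous_im.comp_continuousOn h1).sub continuous_snd.continuousOn).div_const _
  have hgZ : Set.MapsTo g S (Set.range ((↑) : ℤ → ℝ)) := by
    intro p hp
    obtain ⟨m, hm⟩ := Complex.exp_eq_exp_iff_exists_int.1 (hlog _ (hmaps hp))
    refine ⟨m, ?_⟩
    have h1 := congrArg Complex.im hm
    have h2 : (logS (Complex.exp (e p))).im = p.2 + m * (2 * Real.pi) := by
      rw [h1]; simp [e]
    simp only [g]
    rw [h2]
    field_simp
    ring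
  have hdisc : IsDiscrete (Set.range ((↑) : ℤ → ℝ)) :=
    Int.isClosedEmbedding_coe_real.isInducing.isDiscrete_range
  obtain ⟨y, -, hy⟩ := hconn.eqOn_const_of_mapsTo hdisc hg hgZ ⟨_, ⟨0, rfl⟩⟩
  refine ⟨max |α| |β| + |y * (2 * Real.pi)|, ?_⟩
  rintro x ⟨ρ, θ, hρ, hα, hβ, rfl⟩
  have hx : (ρ : ℂ) * Complex.exp (θ * Complex.I) = Complex.exp (e (Real.log ρ, θ)) := by
    simp only [e]
    rw [Complex.exp_add, ← Complex.ofReal_exp, Real.exp_log hρ]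
  have h1 : ((logS (Complex.exp (e (Real.log ρ, θ)))).im - θ) / (2 * Real.pi) = y :=
    hy (show (Real.log ρ, θ) ∈ S from ⟨trivial, hα, hβ⟩)
  rw [div_eq_iff (by positivity)] at h1
  rw [hx, show (logS (Complex.exp (e (Real.log ρ, θ)))).im = θ + y * (2 * Real.pi) by linarith]
  exact (abs_add_le _ _).trans (add_le_add_left (abs_le_max_abs_abs hα.le hβ.le) _)

end GenSeries

end

open GenSeries in
theorem mainTheorem3 (n ℓ : ℕ) (hℓ : 2 ≤ ℓ) (F : (Fin (n + 2) → ℂ) → ℂ) (hF : AnalyticAt ℂ F 0)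
    (φ : GenSeries.GenPowerSeries) (hφ : GenSeries.IsFormalMahlerSolution n ℓ hℓ F φ)
    (A₀ ν : ℂ) (hA₀ : A₀ ≠ 0)
    (hder : GenSeries.HasForm
      (GenSeries.substCoeff (GenSeries.partialY0 F) (GenSeries.mahlerTuple n ℓ hℓ φ)) A₀ ν)
    (α β : ℝ) (hαβ : α < β) (hopen : β - α < 2 * Real.pi)
    (logS : ℂ → ℂ) (hlog_cont : ContinuousOn logS (GenSeries.sector α β))
    (hlog : ∀ x ∈ GenSeries.sector α β, Complex.exp (logS x) = x) :
    ∃ R : ℝ, 0 < R ∧ ∃ f : ℂ → ℂ,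
      TendstoUniformlyOn
        (fun (N : ℕ) (x : ℂ) =>
          ∑ k ∈ Finset.range N, φ.coeff k * Complex.exp (φ.exponent k * logS x))
        f Filter.atTop (GenSeries.sector α β ∩ Metric.ball 0 R) := by
  obtain ⟨K, r, hr, hsum, hcone⟩ := exists_summable_of_solution n ℓ hℓ hF φ hφ hA₀ hder
  obtain ⟨T, hT⟩ := exists_abs_im_log_le hlog_cont hlog
  -- The factor `e^{-KT}` compensates `|e^{-i...}|`-type growth: `-Im λ · Im log x ≤ K T Re λ` by
  -- the cone condition.
  refine ⟨r * Real.exp (-(K * T)), by positivity, _, tendstoUniformlyOn_tsum_nat hsum ?_⟩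
  rintro k x ⟨hxS, hxR⟩
  by_cases hk : φ.coeff k = 0
  · simp [hk]
  rw [norm_mul]
  refine mul_le_mul_of_nonneg_left ?_ (norm_nonneg _)
  rw [Complex.norm_exp, Real.rpow_def_of_pos hr, Complex.mul_re]
  refine Real.exp_le_exp.2 ?_
  have hnorm : ‖x‖ = Real.exp (logS x).re := by
    rw [← Complex.norm_exp, hlog x hxS]
  have hre : (logS x).re ≤ Real.log r - K * T := by
    rw [mem_ball_zero_iff, hnorm] at hxR
    have h1 : r * Real.exp (-(K * T)) = Real.exp (Real.log r - K * T) := by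
      rw [sub_eq_add_neg, Real.exp_add, Real.exp_log hr]
    rw [h1] at hxR
    exact (Real.exp_lt_exp.1 hxR).le
  have h2 : -((φ.exponent k).im * (logS x).im) ≤ K * (φ.exponent k).re * T := by
    refine (neg_le_abs _).trans ?_
    rw [abs_mul]
    exact mul_le_mul (hcone k hk) (hT x hxS) (abs_nonneg _) ((abs_nonneg _).trans (hcone k hk))
  have h3 := mul_le_mul_of_nonneg_left hre (φ.re_pos k).le
  linarith
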